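/- Let $\mathbb{K}=\mathbb{R}$ or $\mathbb{C}$, let $E$ be an $F$-space over $\mathbb{K}$ (a topological vector space whose topology is induced by a complete translation-invariant metric), and let $W$ be a (not necessarily closed) vector subspace of $E$ that contains a non-minimal closed subspace of $E$. Here a topological vector space is called minimal if it admits no strictly weaker Hausdorff vector topology. Then the following conditions are equivalent: 1. $E\setminus W$ is spaceable, i.e. $(E\setminus W)\cup\{0\}$ contains a closed infinite-dimensional subspace of $E$; 2. there are a closed subspace $\mathcal{S}$ of $\ell_\infty$ (over $\mathbb{K}$) containing $c_0$ and an $\mathcal{S}$-independent sequence $(x_n)_{n=1}^\infty$ in $E$ (i.e. if $(c_n)_{n=1}^\infty\in\mathcal{S}$ and $\sum_{n=1}^\infty c_nx_n=0$, then $c_n=0$ for all $n$) such that $E\setminus W$ is $[(x_n)_{n=1}^\infty,\mathcal{S}]$-lineable, i.e. for every $(c_n)_{n=1}^\infty\in\mathcal{S}$ the series $\sum_{n=1}^\infty c_nx_n$ converges in $E$ to a vector in $(E\setminus W)\cup\{0\}$; 3. for every integer $n\ge 1$, $E\setminus W$ is $(n,\mathfrak{c})$-spaceable, i.e. $(E\setminus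 W)\cup\{0\}$ contains an $n$-dimensional subspace, and every $n$-dimensional subspace of $E$ contained in $(E\setminus W)\cup\{0\}$ is contained in a closed subspace $G$ of $E$ with $G\subseteq(E\setminus W)\cup\{0\}$ and $\dim G=\mathfrak{c}$ (algebraic dimension), where $\mathfrak{c}$ is the cardinality of $\mathbb{R}$. -/

import Mathlib

open Filter Topology
open scoped ENNReal Cardinal

/-- `E` is an F-space over `𝕜`: a topological vector space whose topology is induced by a complete
translation-invariant metric. -/
class IsFSpace (𝕜 E : Type*) [RCLike 𝕜] [AddCommGroup E] [Module 𝕜 E] [τ : TopologicalSpace E] :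
    Prop extends IsTopologicalAddGroup E, ContinuousSMul 𝕜 E where
  exists_metric : ∃ m : MetricSpace E, m.toUniformSpace.toTopologicalSpace = τ ∧
    (∀ x y z : E, m.dist (x + z) (y + z) = m.dist x y) ∧ @CompleteSpace E m.toUniformSpace

/-- A topological vector space `F` is minimal if there is no strictly weaker Hausdorff vector
topology on it. In Mathlib's order on topologies, `τ < σ` says that `σ` is strictly weaker
(coarser) than `τ`. -/
def IsMinimalTVS (𝕜 F : Type*) [RCLike 𝕜] [AddCommGroup F] [Module 𝕜 F]
    [τ : TopologicalSpace F] : Prop :=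
  ¬ ∃ σ : TopologicalSpace F, τ < σ ∧ @T2Space F σ ∧
    @IsTopologicalAddGroup F σ _ ∧ @ContinuousSMul 𝕜 F _ _ σ

section Sequences

variable {𝕜 E : Type*} [RCLike 𝕜] [AddCommGroup E] [Module 𝕜 E] [TopologicalSpace E]

/-- The series `c₀ u₀ + c₁ u₁ + ⋯` converges to `x` (convergence of the partial sums). -/
def SeriesConvergesTo (c : ℕ → 𝕜) (u : ℕ → E) (x : E) : Prop :=
  Tendsto (fun N : ℕ => ∑ n ∈ Finset.range N, c n • u n) atTop (𝓝 x)

/-- `(uₙ)` is `S`-independent: the only `c ∈ S` with `∑ cₙ uₙ = 0` is `c = 0`. -/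
def SeqIndependent (u : ℕ → E) (S : Submodule 𝕜 (ℕ → 𝕜)) : Prop :=
  ∀ c ∈ S, SeriesConvergesTo c u 0 → c = 0

/-- `A` is `[(uₙ), S]`-lineable: for every `c ∈ S` the series `∑ cₙ uₙ` converges to a vector of
`A ∪ {0}`. -/
def SeqLineable (u : ℕ → E) (S : Submodule 𝕜 (ℕ → 𝕜)) (A : Set E) : Prop :=
  ∀ c ∈ S, ∃ x ∈ A ∪ {0}, SeriesConvergesTo c u x

end Sequences

/-- The inclusion of `ℓ_∞` into the space of all scalar sequences. -/
def linftyToSeq (𝕜 : Type*) [RCLike 𝕜] : lp (fun _ : ℕ => 𝕜) ∞ →ₗ[𝕜] (ℕ → 𝕜) where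
  toFun x := fun n => x n
  map_add' _ _ := rfl
  map_smul' _ _ := rfl

section Lineability

universe u

variable (𝕜 : Type*) {E : Type u} [RCLike 𝕜] [AddCommGroup E] [Module 𝕜 E]

/-- `A` is `α`-lineable: some `α`-dimensional subspace `F` satisfies `F ∖ {0} ⊆ A`. -/
def IsLineable (α : Cardinal.{u}) (A : Set E) : Prop :=
  ∃ F : Submodule 𝕜 E, Module.rank 𝕜 F = α ∧ (F : Set E) \ {0} ⊆ A

/-- `A` is spaceable: `A ∪ {0}` contains a closed infinite-dimensional subspace. -/
def IsSpaceable [TopologicalSpace E] (A : Set E) : Prop :=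
  ∃ F : Submodule 𝕜 E, IsClosed (F : Set E) ∧ ℵ₀ ≤ Module.rank 𝕜 F ∧ (F : Set E) ⊆ A ∪ {0}

/-- `A` is `(α, β)`-spaceable: `A` is `α`-lineable, and every `α`-dimensional subspace contained in
`A ∪ {0}` is contained in a closed `β`-dimensional subspace contained in `A ∪ {0}`. -/
def IsPairSpaceable [TopologicalSpace E] (α β : Cardinal.{u}) (A : Set E) : Prop :=
  IsLineable 𝕜 α A ∧
    ∀ F : Submodule 𝕜 E, Module.rank 𝕜 F = α → (F : Set E) ⊆ A ∪ {0} →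
      ∃ G : Submodule 𝕜 E, IsClosed (G : Set E) ∧ Module.rank 𝕜 G = β ∧ F ≤ G ∧
        (G : Set E) ⊆ A ∪ {0}

end Lineability

/-!
Everything is measured with an F-norm `p` that induces the topology of `E`. The three conditions are
linked through sequences `(xₙ)` that are boundedly free modulo `W`: `∑ p (xₙ) < ∞`, and no nonzero
bounded sequence `c` has `∑ cₙ xₙ ∈ W` (`IsBoundedlyFree`).

*From subspaces to sequences.* Vectors `eₙ` that are independent modulo a closed subspace `D` can be
multiplied by scalars so that the tail after `m` terms is smaller than the distance from `D` to
the combinations of the first `m` vectors with a coefficient of modulus `≥ 1 / (m + 1)`. A bounded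
combination in `D` then has all its first `m` coefficients below `1 / (m + 1)`, for every `m`, hence
vanishes (`IsFNorm.exists_isBoundedlyFree`). If a closed infinite-dimensional `F` meets `W` trivially
and `F₀` is finite-dimensional, this applies to the finite-dimensional space `D = F ∩ (W + F₀)` and
gives a sequence in `F` that is boundedly free modulo `W + F₀`
(`IsFNorm.exists_isBoundedlyFree_sup`). Such a sequence satisfies the second condition with all of
`ℓ_∞`; conversely a sequence as in the second condition becomes boundedly free when it is
multiplied by a sufficiently small null sequence.

*From sequences to subspaces.* Let `Y ≤ W` be closed with a strictly weaker Hausdorff vector topology.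
The weak closures of the `p`-balls of `Y` are the balls of an F-norm `q` that is weakly lower
semicontinuous; by the open mapping argument, its topology is strictly finer than the weak one
(`IsFNorm.exists_isPolarFNorm`). Hence there are weakly small vectors with `q` bounded below, and
choosing them inductively by compactness produces a sequence `(yₙ)` in `Y` which is basic for `q`
(`IsPolarFNorm.exists_isBasicFor`). If `(xₙ)` is boundedly free modulo `W`, the closed span of
`(yₙ + xₙ)` meets `W` only at `0`, because `∑ aₙ yₙ ↦ ∑ aₙ xₙ` behaves like a compact operator
(`IsBasicFor.eq_zero_of_mem_closure`).

*Dimension.* The closed span of an independent sequence has dimension exactly `𝔠`: at least,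
because the sums `∑ ρⁿ xₙ` of a boundedly free sequence in it are independent for `0 < ρ < 1`, and at
most, because it has at most `𝔠` elements. For the third condition, the closed span obtained modulo
`W + F₀` is added to the given finite-dimensional space `F₀`.
-/

/-! ### F-norms -/

/-- `p` is an F-norm which induces the topology of `E` and for which `E` is complete. Completeness is
expressed through series: if `∑ p (uₙ) < ∞`, then `∑ uₙ` converges. -/
structure IsFNorm (𝕜 : Type*) {E : Type*} [RCLike 𝕜] [AddCommGroup E] [Module 𝕜 E]
    [TopologicalSpace E] (p : E → ℝ) : Prop where
  nonneg : ∀ x, 0 ≤ p x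
  add_le : ∀ x y, p (x + y) ≤ p x + p y
  smul_le : ∀ (a : 𝕜) (x : E), ‖a‖ ≤ 1 → p (a • x) ≤ p x
  basis : (𝓝 (0 : E)).HasBasis (fun r : ℝ => 0 < r) (fun r => {x | p x < r})
  exists_sum : ∀ u : ℕ → E, Summable (fun n => p (u n)) →
    ∃ x, Tendsto (fun N : ℕ => ∑ n ∈ Finset.range N, u n) atTop (𝓝 x)

/-- The F-norm is `p x = sup {d (a x, 0) : ‖a‖ ≤ 1}`, where `d` is a complete invariant metric. -/
theorem IsFSpace.exists_isFNorm (𝕜 E : Type*) [RCLike 𝕜] [AddCommGroup E] [Module 𝕜 E]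
    [τ : TopologicalSpace E] [h : IsFSpace 𝕜 E] : T2Space E ∧ ∃ p : E → ℝ, IsFNorm 𝕜 p := by
  obtain ⟨m, rfl, hinv, hcomp⟩ := h.exists_metric
  let := m
  have hT : IsTopologicalAddGroup E := h.toIsTopologicalAddGroup
  have hS : ContinuousSMul 𝕜 E := h.toContinuousSMul
  refine ⟨inferInstance, ?_⟩
  have hinv' : ∀ x y z : E, dist (x + z) (y + z) = dist x y := hinv
  let S (x : E) : Set ℝ := (fun a : 𝕜 => dist (a • x) 0) '' Metric.closedBall 0 1
  have hbdd : ∀ x, BddAbove (S x) := fun x =>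
    ((isCompact_closedBall (0 : 𝕜) 1).image (by fun_prop)).bddAbove
  have hmem : ∀ (a : 𝕜) x, ‖a‖ ≤ 1 → dist (a • x) 0 ∈ S x := fun a x ha =>
    ⟨a, by simpa using ha, rfl⟩
  have hle : ∀ (a : 𝕜) x, ‖a‖ ≤ 1 → dist (a • x) 0 ≤ sSup (S x) := fun a x ha =>
    le_csSup (hbdd x) (hmem a x ha)
  have hge : ∀ x r, (∀ a : 𝕜, ‖a‖ ≤ 1 → dist (a • x) 0 ≤ r) → sSup (S x) ≤ r := fun x r hr => by
    apply csSup_le ⟨_, hmem 0 x (by simp)⟩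
    rintro _ ⟨a, ha, rfl⟩
    exact hr a (by simpa using ha)
  have hd : ∀ x, dist x 0 ≤ sSup (S x) := fun x => by
    simpa using hle 1 x (by simp)
  refine ⟨fun x => sSup (S x), ⟨fun x => dist_nonneg.trans (hd x), fun x y => ?_,
    fun a x ha => ?_, ?_, ?_⟩⟩
  · refine hge _ _ fun a ha => ?_
    calc dist (a • (x + y)) 0 ≤ dist (a • x + a • y) (0 + a • y) + dist (a • y) 0 := by
          rw [smul_add, zero_add]; exact dist_triangle _ _ _
      _ ≤ _ := by rw [hinv']; exact add_le_add (hle a x ha) (hle a y ha)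
  · refine hge _ _ fun b hb => ?_
    rw [smul_smul]
    exact hle _ _ (by rw [norm_mul]; exact mul_le_one₀ hb (norm_nonneg _) ha)
  · refine Metric.nhds_basis_ball.to_hasBasis (fun r hr => ⟨r, hr, fun x hx => ?_⟩) fun r hr => ?_
    · exact (hd x).trans_lt hx
    · obtain ⟨U, ⟨hU, hUb⟩, hUr⟩ := (nhds_basis_balanced 𝕜 E).mem_iff.1
        (Metric.ball_mem_nhds (0 : E) (half_pos hr))
      obtain ⟨s, hs, hsU⟩ := Metric.mem_nhds_iff.1 hU
      refine ⟨s, hs, fun x hx => ?_⟩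
      have : sSup (S x) ≤ r / 2 := hge _ _ fun a ha =>
        (Metric.mem_ball.1 (hUr (hUb a ha (Set.smul_mem_smul_set (hsU hx))))).le
      exact this.trans_lt (half_lt_self hr)
  · intro u hu
    apply cauchySeq_tendsto_of_complete
    refine cauchySeq_of_summable_dist (hu.of_nonneg_of_le (fun _ => dist_nonneg) fun n => ?_)
    rw [Finset.sum_range_succ, add_comm, dist_comm]
    calc _ = dist (u n + ∑ n ∈ Finset.range n, u n) (0 + ∑ n ∈ Finset.range n, u n) := by
          rw [zero_add]
      _ ≤ _ := by rw [hinv']; exact hd _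

namespace IsFNorm

variable {𝕜 E : Type*} [RCLike 𝕜] [AddCommGroup E] [Module 𝕜 E] [TopologicalSpace E] {p : E → ℝ}

theorem map_zero (hp : IsFNorm 𝕜 p) : p 0 = 0 :=
  le_antisymm (le_of_forall_pos_lt_add fun r hr => by
    have : (0 : E) ∈ {x | p x < r} := mem_of_mem_nhds (hp.basis.mem_of_mem hr)
    simpa using this) (hp.nonneg 0)

theorem map_smul_eq (hp : IsFNorm 𝕜 p) {a : 𝕜} (ha : ‖a‖ = 1) (x : E) : p (a • x) = p x := by
  refine le_antisymm (hp.smul_le a x ha.le) ?_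
  have := hp.smul_le a⁻¹ (a • x) (by simp [ha])
  rwa [inv_smul_smul₀ (by rintro rfl; simp at ha)] at this

theorem map_neg (hp : IsFNorm 𝕜 p) (x : E) : p (-x) = p x := by
  simpa using hp.map_smul_eq (𝕜 := 𝕜) (a := -1) (by simp) x

theorem sub_le (hp : IsFNorm 𝕜 p) (x y : E) : p (x - y) ≤ p x + p y := by
  simpa [sub_eq_add_neg, hp.map_neg] using hp.add_le x (-y)

theorem le_add_sub (hp : IsFNorm 𝕜 p) (x y : E) : p x ≤ p y + p (x - y) := by
  simpa using hp.add_le y (x - y)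

theorem sum_le (hp : IsFNorm 𝕜 p) {ι : Type*} (s : Finset ι) (u : ι → E) :
    p (∑ i ∈ s, u i) ≤ ∑ i ∈ s, p (u i) :=
  Finset.le_sum_of_subadditive p hp.map_zero.le hp.add_le s u

theorem tendsto_zero_iff (hp : IsFNorm 𝕜 p) {ι : Type*} {l : Filter ι} {u : ι → E} :
    Tendsto u l (𝓝 0) ↔ Tendsto (fun i => p (u i)) l (𝓝 0) := by
  rw [hp.basis.tendsto_right_iff, Metric.tendsto_nhds]
  simp [abs_of_nonneg (hp.nonneg _)]

/-- Every vector has nonzero multiples of small F-norm, with a small scalar. -/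
theorem exists_smul_le [ContinuousSMul 𝕜 E] (hp : IsFNorm 𝕜 p) (x : E) {r : ℝ} (hr : 0 < r) :
    ∃ a : 𝕜, a ≠ 0 ∧ ‖a‖ ≤ r ∧ p (a • x) < r := by
  have h1 : Tendsto (fun n : ℕ => (((n : ℝ) + 1 : ℝ) : 𝕜)⁻¹) atTop (𝓝 0) := by
    have := (tendsto_one_div_add_atTop_nhds_zero_nat (𝕜 := ℝ))
    have h2 := (RCLike.continuous_ofReal (K := 𝕜)).tendsto 0 |>.comp this
    simpa [Function.comp_def] using h2
  have h2 : Tendsto (fun n : ℕ => (((n : ℝ) + 1 : ℝ) : 𝕜)⁻¹ • x) atTop (𝓝 0) := by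
    simpa using h1.smul_const x
  have h3 := (hp.tendsto_zero_iff.1 h2).eventually (gt_mem_nhds hr)
  have h4 := (tendsto_zero_iff_norm_tendsto_zero.1 h1).eventually (gt_mem_nhds hr)
  obtain ⟨n, hn, hn'⟩ := (h3.and h4).exists
  refine ⟨_, ?_, hn'.le, hn⟩
  rw [Ne, inv_eq_zero, RCLike.ofReal_eq_zero]
  positivity

/-- The F-norm restricts to closed subspaces. -/
theorem restrict (hp : IsFNorm 𝕜 p) (Y : Submodule 𝕜 E) (hY : IsClosed (Y : Set E)) :
    IsFNorm 𝕜 (fun y : Y => p y) where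
  nonneg y := hp.nonneg y
  add_le x y := hp.add_le x y
  smul_le a x ha := hp.smul_le a x ha
  basis := by
    have : 𝓝 (0 : Y) = comap Subtype.val (𝓝 (0 : E)) := nhds_induced _ _
    rw [this]
    exact hp.basis.comap _
  exists_sum u hu := by
    obtain ⟨x, hx⟩ := hp.exists_sum (fun n => (u n : E)) hu
    have hxY : x ∈ Y := hY.mem_of_tendsto hx (Eventually.of_forall fun N =>
      Y.sum_mem fun i _ => (u i).2)
    refine ⟨⟨x, hxY⟩, tendsto_subtype_rng.2 ?_⟩
    simpa using hx

variable [IsTopologicalAddGroup E]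

theorem tendsto_iff (hp : IsFNorm 𝕜 p) {ι : Type*} {l : Filter ι} {u : ι → E} {x : E} :
    Tendsto u l (𝓝 x) ↔ Tendsto (fun i => p (u i - x)) l (𝓝 0) := by
  rw [← hp.tendsto_zero_iff, tendsto_sub_nhds_zero_iff]

/-- A function dominated by the F-norm in the sense of `q x ≤ q y + p (x - y)` is continuous. -/
theorem continuous_of_le (hp : IsFNorm 𝕜 p) {q : E → ℝ} (hq : ∀ x y, q x ≤ q y + p (x - y)) :
    Continuous q := by
  refine continuous_iff_continuousAt.2 fun x => ?_
  have h : Tendsto (fun y => p (y - x)) (𝓝 x) (𝓝 0) := hp.tendsto_iff.1 tendsto_id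
  refine tendsto_iff_norm_sub_tendsto_zero.2 (squeeze_zero (fun _ => norm_nonneg _) (fun y => ?_) h)
  rw [Real.norm_eq_abs, abs_le]
  have h1 := hq x y
  have h2 := hq y x
  rw [← neg_sub, hp.map_neg] at h1
  constructor <;> linarith

theorem continuous (hp : IsFNorm 𝕜 p) : Continuous p := hp.continuous_of_le hp.le_add_sub

/-- The topology is generated by the countably many sets `{p < 1 / (n + 1)}` at the origin. -/
theorem firstCountable (hp : IsFNorm 𝕜 p) : FirstCountableTopology E := by
  have h0 : (𝓝 (0 : E)) = comap p (𝓝 0) := by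
    refine hp.basis.eq_of_same_basis ?_
    refine (Metric.nhds_basis_ball.comap p).congr (fun _ => Iff.rfl) fun r _ => ?_
    ext x
    simp [abs_of_nonneg (hp.nonneg _)]
  have : (𝓝 (0 : E)).IsCountablyGenerated := by rw [h0]; infer_instance
  refine ⟨fun x => ?_⟩
  rw [← map_add_left_nhds_zero]
  infer_instance

end IsFNorm

/-! ### Sequences that are independent for bounded coefficients -/

/-- Recursive construction of a sequence in which every term is a function of all earlier ones. -/
theorem exists_seq_of_prefix {X : Type*} (F : ∀ m : ℕ, (Fin m → X) → X) :
    ∃ y : ℕ → X, ∀ m, y m = F m (fun i => y i) := by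
  let G : ∀ m : ℕ, (∀ i < m, X) → X := fun m g => F m fun i => g i i.2
  refine ⟨Nat.lt_wfRel.wf.fix (C := fun _ => X) G, fun m => ?_⟩
  exact WellFounded.fix_eq _ _ _

/-- `x` is summable in F-norm, and no nonzero bounded combination `∑ cₙ xₙ` lies in `W`. -/
structure IsBoundedlyFree {𝕜 E : Type*} [RCLike 𝕜] [AddCommGroup E] [Module 𝕜 E]
    [TopologicalSpace E] (p : E → ℝ) (x : ℕ → E) (W : Submodule 𝕜 E) : Prop where
  summable : Summable fun n => p (x n)
  eq_zero : ∀ c : ℕ → 𝕜, (∀ n, ‖c n‖ ≤ 1) → ∀ s ∈ W, SeriesConvergesTo c x s → c = 0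

section

variable {𝕜 E : Type*} [RCLike 𝕜] [AddCommGroup E] [Module 𝕜 E] [TopologicalSpace E] {p : E → ℝ}

theorem SeriesConvergesTo.smul [ContinuousSMul 𝕜 E] {c : ℕ → 𝕜} {x : ℕ → E} {s : E}
    (h : SeriesConvergesTo c x s) (t : 𝕜) : SeriesConvergesTo (t • c) x (t • s) := by
  simpa [SeriesConvergesTo, Finset.smul_sum, smul_smul] using Tendsto.const_smul h t

theorem SeriesConvergesTo.sub [IsTopologicalAddGroup E] {c d : ℕ → 𝕜} {x : ℕ → E} {s t : E}
    (h : SeriesConvergesTo c x s) (h' : SeriesConvergesTo d x t) :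
    SeriesConvergesTo (c - d) x (s - t) := by
  simpa [SeriesConvergesTo, sub_smul] using Tendsto.sub h h'

theorem IsFNorm.exists_seriesConvergesTo (hp : IsFNorm 𝕜 p) {x : ℕ → E}
    (hx : Summable fun n => p (x n)) {c : ℕ → 𝕜} (hc : ∀ n, ‖c n‖ ≤ 1) :
    ∃ s, SeriesConvergesTo c x s :=
  hp.exists_sum _ (hx.of_nonneg_of_le (fun _ => hp.nonneg _) fun n => hp.smul_le _ _ (hc n))

theorem IsFNorm.exists_seriesConvergesTo_of_bounded [ContinuousSMul 𝕜 E] (hp : IsFNorm 𝕜 p)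
    {x : ℕ → E} (hx : Summable fun n => p (x n)) {c : ℕ → 𝕜} {M : ℝ} (hc : ∀ n, ‖c n‖ ≤ M) :
    ∃ s, SeriesConvergesTo c x s := by
  have hM : 0 < |M| + 1 := by positivity
  obtain ⟨s, hs⟩ := hp.exists_seriesConvergesTo hx (c := ((|M| + 1 : ℝ) : 𝕜)⁻¹ • c) fun n => by
    rw [Pi.smul_apply, norm_smul, norm_inv, RCLike.norm_ofReal, abs_of_pos hM,
      inv_mul_le_iff₀ hM, mul_one]
    linarith [hc n, le_abs_self M]
  refine ⟨((|M| + 1 : ℝ) : 𝕜) • s, ?_⟩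
  have := hs.smul ((|M| + 1 : ℝ) : 𝕜)
  rwa [smul_inv_smul₀ (by exact_mod_cast hM.ne')] at this

theorem IsBoundedlyFree.eq_zero_of_bounded [ContinuousSMul 𝕜 E] {x : ℕ → E} {W : Submodule 𝕜 E}
    (h : IsBoundedlyFree p x W) {c : ℕ → 𝕜} {M : ℝ} (hc : ∀ n, ‖c n‖ ≤ M) {s : E} (hs : s ∈ W)
    (hcs : SeriesConvergesTo c x s) : c = 0 := by
  have hM : 0 < |M| + 1 := by positivity
  have := h.eq_zero (((|M| + 1 : ℝ) : 𝕜)⁻¹ • c) (fun n => by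
    rw [Pi.smul_apply, norm_smul, norm_inv, RCLike.norm_ofReal, abs_of_pos hM,
      inv_mul_le_iff₀ hM, mul_one]
    linarith [hc n, le_abs_self M]) _ (W.smul_mem _ hs) (hcs.smul _)
  refine (smul_eq_zero.1 this).resolve_left (inv_ne_zero (by exact_mod_cast hM.ne'))

variable [IsTopologicalAddGroup E]

/-- The F-norm of a convergent series is at most the sum of the F-norms. -/
theorem IsFNorm.le_tsum (hp : IsFNorm 𝕜 p) {x : ℕ → E} {c : ℕ → 𝕜} {s : E}
    (hc : Summable fun n => p (c n • x n)) (hs : SeriesConvergesTo c x s) :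
    p s ≤ ∑' n, p (c n • x n) := by
  refine le_of_tendsto ((hp.continuous.tendsto s).comp hs) (Eventually.of_forall fun N => ?_)
  exact (hp.sum_le _ _).trans (hc.sum_le_tsum _ fun _ _ => hp.nonneg _)

theorem IsFNorm.tail_le_tsum (hp : IsFNorm 𝕜 p) {x : ℕ → E} (hx : Summable fun n => p (x n))
    {c : ℕ → 𝕜} (hc : ∀ n, ‖c n‖ ≤ 1) {s : E} (hs : SeriesConvergesTo c x s) (m : ℕ) :
    p (∑ i ∈ Finset.range m, c i • x i - s) ≤ ∑' n, p (x (n + m)) := by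
  have h1 : Tendsto (fun N : ℕ => ∑ i ∈ Finset.range m, c i • x i -
      ∑ i ∈ Finset.range (N + m), c i • x i) atTop (𝓝 (∑ i ∈ Finset.range m, c i • x i - s)) :=
    tendsto_const_nhds.sub ((tendsto_add_atTop_iff_nat m).2 hs)
  refine le_of_tendsto ((hp.continuous.tendsto _).comp h1) (Eventually.of_forall fun N => ?_)
  have h2 : ∑ i ∈ Finset.range m, c i • x i - ∑ i ∈ Finset.range (N + m), c i • x i
      = - ∑ i ∈ Finset.range N, c (i + m) • x (i + m) := by
    rw [add_comm N m, Finset.sum_range_add]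
    simp [add_comm]
  rw [Function.comp_apply, h2, hp.map_neg]
  calc _ ≤ _ := hp.sum_le _ _
    _ ≤ ∑ i ∈ Finset.range N, p (x (i + m)) :=
      Finset.sum_le_sum fun i _ => hp.smul_le _ _ (hc _)
    _ ≤ _ := ((summable_nat_add_iff m).2 hx).sum_le_tsum _ fun _ _ => hp.nonneg _

variable [ContinuousSMul 𝕜 E]

/-- Combinations of finitely many vectors that are independent modulo a closed subspace `D` keep a
positive distance from `D` as long as some coefficient is not small. -/
theorem IsFNorm.exists_le_sub (hp : IsFNorm 𝕜 p) {D : Submodule 𝕜 E} (hD : IsClosed (D : Set E))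
    {m : ℕ} {x : Fin m → E} (hx : LinearIndependent 𝕜 fun i => D.mkQ (x i)) {r : ℝ} (hr : 0 < r) :
    ∃ η > 0, ∀ a : Fin m → 𝕜, (∃ i, r ≤ ‖a i‖) → ∀ d ∈ D, η ≤ p (∑ i, a i • x i - d) := by
  have hK : IsCompact ((fun a : Fin m → 𝕜 => ∑ i, a i • x i) '' Metric.sphere 0 r) :=
    (isCompact_sphere _ _).image (by fun_prop)
  have hKD : (fun a : Fin m → 𝕜 => ∑ i, a i • x i) '' Metric.sphere 0 r ⊆ (D : Set E)ᶜ := by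
    rintro _ ⟨a, ha, rfl⟩ haD
    have h0 : D.mkQ (∑ i, a i • x i) = 0 := (Submodule.Quotient.mk_eq_zero D).2 haD
    rw [map_sum] at h0
    simp only [map_smul] at h0
    have : a = 0 := funext (Fintype.linearIndependent_iff.1 hx a h0)
    rw [mem_sphere_zero_iff_norm, this, norm_zero] at ha
    exact hr.ne ha
  obtain ⟨V, hV, hKV⟩ := compact_open_separated_add_right hK hD.isOpen_compl hKD
  obtain ⟨η, hη, hηV⟩ := hp.basis.mem_iff.1 hV
  refine ⟨η, hη, fun a ⟨i, hi⟩ d hd => le_of_not_gt fun hlt => ?_⟩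
  have hra : r ≤ ‖a‖ := hi.trans (norm_le_pi_norm a i)
  have ha : 0 < ‖a‖ := hr.trans_le hra
  set t : 𝕜 := ((r / ‖a‖ : ℝ) : 𝕜) with ht
  have htn : ‖t‖ = r / ‖a‖ := by
    rw [ht, RCLike.norm_ofReal, abs_of_nonneg (by positivity)]
  have ht1 : ‖t‖ ≤ 1 := by rw [htn]; exact (div_le_one ha).2 hra
  have h1 : t • d - ∑ i, (t • a) i • x i ∈ V := by
    apply hηV
    have : t • d - ∑ i, (t • a) i • x i = -(t • (∑ i, a i • x i - d)) := by
      simp [smul_sub, Finset.smul_sum, smul_smul]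
    rw [Set.mem_ofPred_eq, this, hp.map_neg]
    exact (hp.smul_le t _ ht1).trans_lt hlt
  refine hKV (Set.add_mem_add ⟨t • a, ?_, rfl⟩ h1) ?_
  · rw [mem_sphere_zero_iff_norm, norm_smul, htn, div_mul_cancel₀ _ ha.ne']
  · simpa using D.smul_mem t hd

/-- Vectors independent modulo a closed subspace `D` become independent modulo `D` for bounded
coefficients once they are multiplied by scalars which decrease fast enough. -/
theorem IsFNorm.exists_isBoundedlyFree (hp : IsFNorm 𝕜 p) {D : Submodule 𝕜 E}
    (hD : IsClosed (D : Set E)) {e : ℕ → E} (he : LinearIndependent 𝕜 fun n => D.mkQ (e n)) :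
    ∃ a : ℕ → 𝕜, IsBoundedlyFree p (fun n => a n • e n) D := by
  classical
  -- `η m a` bounds from below the distance from `D` of the combinations of the first `m` vectors
  -- with a coefficient of modulus at least `1 / (m + 1)`.
  have hη : ∀ (m : ℕ) (a : Fin m → 𝕜), ∃ η > 0, (∀ i, a i ≠ 0) → ∀ b : Fin m → 𝕜,
      (∃ i, 1 / ((m : ℝ) + 1) ≤ ‖b i‖) → ∀ d ∈ D, η ≤ p (∑ i, b i • a i • e i - d) := by
    intro m a
    by_cases ha : ∀ i, a i ≠ 0
    · have h1 : LinearIndependent 𝕜 fun i : Fin m => D.mkQ (a i • e i) := by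
        have h2 := (he.comp (fun i : Fin m => (i : ℕ)) Fin.val_injective).units_smul
          (fun i => Units.mk0 (a i) (ha i))
        simpa [Function.comp_def, Pi.smul_def'] using h2
      obtain ⟨η, hη, h⟩ := hp.exists_le_sub hD h1 (r := 1 / ((m : ℝ) + 1)) (by positivity)
      exact ⟨η, hη, fun _ => h⟩
    · exact ⟨1, one_pos, fun h => absurd h ha⟩
  choose η hη0 hη using hη
  have hF : ∀ (n : ℕ) (a : Fin n → 𝕜), ∃ b : 𝕜, b ≠ 0 ∧ p (b • e n) ≤ (1 / 2) ^ n ∧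
      ∀ m (hm : m ≤ n),
        p (b • e n) ≤ η m (fun i => a (i.castLE hm)) * (1 / 4) * (1 / 2) ^ (n - m) := by
    intro n a
    let f : Fin (n + 1) → ℝ := fun m =>
      η m (fun i => a (i.castLE (Nat.lt_succ_iff.1 m.2))) * (1 / 4) * (1 / 2) ^ (n - m)
    have hf : ∀ m, 0 < f m := fun m => mul_pos (mul_pos (hη0 _ _) (by norm_num)) (by positivity)
    obtain ⟨r, hr, hrf⟩ : ∃ r > 0, ∀ m, r ≤ f m := by
      obtain ⟨m, hm⟩ := Finite.exists_min f
      exact ⟨f m, hf m, hm⟩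
    obtain ⟨b, hb, -, hbr⟩ := hp.exists_smul_le (e n) (r := min r ((1 / 2) ^ n)) (by positivity)
    exact ⟨b, hb, hbr.le.trans (min_le_right _ _), fun m hm =>
      hbr.le.trans ((min_le_left _ _).trans (hrf ⟨m, Nat.lt_succ_of_le hm⟩))⟩
  choose F hF0 hF1 hF2 using hF
  obtain ⟨a, ha⟩ := exists_seq_of_prefix F
  have hsum : Summable fun n => p (a n • e n) :=
    summable_geometric_two.of_nonneg_of_le (fun _ => hp.nonneg _) fun n => by
      rw [ha n]; exact hF1 _ _
  have hne : ∀ n, a n ≠ 0 := fun n => by rw [ha n]; exact hF0 _ _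
  refine ⟨a, hsum, fun c hc s hs hcs => ?_⟩
  -- The tail after `m` terms is at most `η m / 2`, too small to bring the partial sum into `D`.
  have key : ∀ m i, i < m → ‖c i‖ < 1 / ((m : ℝ) + 1) := by
    intro m i hi
    by_contra! hci
    have h1 := hη m (fun i => a i) (fun i => hne i) (fun i => c i) ⟨⟨i, hi⟩, hci⟩ s hs
    rw [Fin.sum_univ_eq_sum_range (fun i => c i • a i • e i)] at h1
    have h2 := hp.tail_le_tsum hsum hc hcs m
    have h3 : ∑' n, p (a (n + m) • e (n + m)) ≤ η m (fun i => a i) * (1 / 4) * 2 := by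
      rw [← tsum_geometric_two, ← tsum_mul_left]
      refine Summable.tsum_le_tsum (fun n => ?_) ((summable_nat_add_iff m).2 hsum)
        (summable_geometric_two.mul_left _)
      have := hF2 (n + m) (fun i => a i) m (Nat.le_add_left _ _)
      rw [← ha (n + m), Nat.add_sub_cancel] at this
      exact this
    have := hη0 m (fun i => a i)
    linarith
  funext i
  rw [Pi.zero_apply, ← norm_le_zero_iff]
  refine ge_of_tendsto tendsto_one_div_add_atTop_nhds_zero_nat
    ((eventually_gt_atTop i).mono fun m hm => (key m i hm).le)

end

/-! ### Semicontinuous regularization of an F-norm -/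

/-- An F-norm `q` on `X` that is dominated by `p` and lower semicontinuous for the weaker topology
which `f : X → Z` induces, while the weaker topology is not finer than that of `q`: every weak
neighbourhood of the origin contains vectors with `q` at least `δ`. -/
structure IsPolarFNorm {𝕜 X Z : Type*} [RCLike 𝕜] [AddCommGroup X] [Module 𝕜 X]
    [AddCommGroup Z] [Module 𝕜 Z] [TopologicalSpace Z]
    (p : X → ℝ) (f : X →ₗ[𝕜] Z) (q : X → ℝ) (δ : ℝ) : Prop where
  nonneg : ∀ x, 0 ≤ q x
  le : ∀ x, q x ≤ p x
  add_le : ∀ x y, q (x + y) ≤ q x + q y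
  smul_le : ∀ (a : 𝕜) (x : X), ‖a‖ ≤ 1 → q (a • x) ≤ q x
  eq_zero : ∀ x, q x = 0 → x = 0
  lsc : ∀ x c, c < q x → ∃ N ∈ 𝓝 (0 : Z), ∀ y, f y ∈ N → c < q (x + y)
  pos : 0 < δ
  exists_le : ∀ N ∈ 𝓝 (0 : Z), ∃ x, f x ∈ N ∧ δ ≤ q x

section

variable {𝕜 X Z : Type*} [RCLike 𝕜] [AddCommGroup X] [Module 𝕜 X] [TopologicalSpace X]
  [AddCommGroup Z] [Module 𝕜 Z] [TopologicalSpace Z]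
  {p : X → ℝ} {f : X →ₗ[𝕜] Z}

theorem IsFNorm.exists_closure_image_subset [IsTopologicalAddGroup Z] (hp : IsFNorm 𝕜 p)
    (hf : Continuous f) {N : Set Z} (hN : N ∈ 𝓝 0) :
    ∃ r > 0, closure (f '' {x | p x ≤ r}) ⊆ N := by
  obtain ⟨N', ⟨hN', hN'c⟩, hN'N⟩ := (closed_nhds_basis (0 : Z)).mem_iff.1 hN
  have h : f ⁻¹' N' ∈ 𝓝 (0 : X) := hf.continuousAt.preimage_mem_nhds (by simpa using hN')
  obtain ⟨r, hr, hrN⟩ := hp.basis.mem_iff.1 h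
  refine ⟨r / 2, half_pos hr, (closure_minimal ?_ hN'c).trans hN'N⟩
  rintro _ ⟨x, hx, rfl⟩
  exact hrN (lt_of_le_of_lt hx (half_lt_self hr))

/-- Open mapping principle: a continuous injection from a complete space which is nearly open is
an embedding. -/
theorem IsFNorm.exists_preimage_subset_of_nearly_open [IsTopologicalAddGroup X]
    [IsTopologicalAddGroup Z] [T2Space Z]
    (hp : IsFNorm 𝕜 p) (hf : Continuous f) (hinj : Function.Injective f)
    (h : ∀ r > 0, ∃ N ∈ 𝓝 (0 : Z), ∀ x, f x ∈ N → f x ∈ closure (f '' {x | p x ≤ r}))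
    {r : ℝ} (hr : 0 < r) : ∃ N ∈ 𝓝 (0 : Z), ∀ x, f x ∈ N → p x ≤ r := by
  have hstep : ∀ s > 0, ∀ t > 0, ∀ x, f x ∈ closure (f '' {x | p x ≤ s}) →
      ∃ y, p y ≤ s ∧ f (x - y) ∈ closure (f '' {x | p x ≤ t}) := by
    intro s _ t ht x hx
    obtain ⟨N, hN, hNt⟩ := h t ht
    have : ∀ᶠ z in 𝓝 (f x), f x - z ∈ N := by
      have h0 : Tendsto (fun z => f x - z) (𝓝 (f x)) (𝓝 0) := by
        simpa using (tendsto_const_nhds (x := f x)).sub (tendsto_id (α := Z) (x := 𝓝 (f x)))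
      exact h0 hN
    obtain ⟨_, hz, y, hy, rfl⟩ := mem_closure_iff_nhds.1 hx _ this
    exact ⟨y, hy, hNt _ (by simpa using hz)⟩
  obtain ⟨N, hN, hNr⟩ := h (r / 2) (half_pos hr)
  refine ⟨N, hN, fun x hx => ?_⟩
  let s : ℕ → ℝ := fun n => r / 2 / 2 ^ n
  have hs : ∀ n, 0 < s n := fun n => by positivity
  choose! g hg1 hg2 using fun n => hstep (s n) (hs n) (s (n + 1)) (hs _)
  -- Successive remainders `w (n + 1) = w n - g n (w n)` of the approximation of `x` by a series.
  let w : ℕ → X := fun n => Nat.rec x (fun n v => v - g n v) n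
  have hw : ∀ n, f (w n) ∈ closure (f '' {x | p x ≤ s n}) := by
    intro n
    induction n with
    | zero => simpa [w, s] using hNr x hx
    | succ n ih => exact hg2 n _ ih
  have hwsum : ∀ n, ∑ i ∈ Finset.range n, g i (w i) = x - w n := by
    intro n
    induction n with
    | zero => simp [w]
    | succ n ih => rw [Finset.sum_range_succ, ih, show w (n + 1) = w n - g n (w n) from rfl]; abel
  have hsum : HasSum s r := hasSum_geometric_two' r
  obtain ⟨y, hy⟩ := hp.exists_sum (fun n => g n (w n))
    (hsum.summable.of_nonneg_of_le (fun _ => hp.nonneg _) fun n => hg1 n _ (hw n))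
  have hyr : p y ≤ r := by
    refine le_of_tendsto ((hp.continuous.tendsto y).comp hy) (Eventually.of_forall fun n => ?_)
    refine (hp.sum_le _ _).trans ((Finset.sum_le_sum fun i _ => hg1 i _ (hw i)).trans ?_)
    exact sum_le_hasSum _ (fun i _ => (hs i).le) hsum
  have hfw : Tendsto (fun n => f (w n)) atTop (𝓝 0) := by
    intro M hM
    obtain ⟨t, ht, htM⟩ := hp.exists_closure_image_subset hf hM
    have hst : ∀ᶠ n in atTop, s n < t :=
      hsum.summable.tendsto_atTop_zero.eventually (gt_mem_nhds ht)
    refine hst.mono fun n hn => ?_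
    refine htM (closure_mono (Set.image_mono fun v hv => ?_) (hw n))
    exact le_trans hv hn.le
  have hfy : Tendsto (fun n => f (x - w n)) atTop (𝓝 (f y)) := by
    simp_rw [← hwsum]
    exact (hf.tendsto y).comp hy
  have : f x = f y := by
    refine tendsto_nhds_unique (f := fun n => f (x - w n)) (l := atTop) ?_ hfy
    simpa using (tendsto_const_nhds (x := f x)).sub hfw
  rwa [hinj this]

/-- If `f` is a continuous injection but not an embedding, then the F-norm whose balls are the
`f`-closures of the balls of `p` is lower semicontinuous with respect to `f`. Its topology is strictly
finer than the one induced by `f`, since otherwise `f` would be nearly open. -/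
theorem IsFNorm.exists_isPolarFNorm [IsTopologicalAddGroup X]
    [IsTopologicalAddGroup Z] [ContinuousSMul 𝕜 Z] [T2Space Z]
    (hp : IsFNorm 𝕜 p) (hf : Continuous f) (hinj : Function.Injective f) {r : ℝ} (hr : 0 < r)
    (h : ∀ N ∈ 𝓝 (0 : Z), ∃ x, f x ∈ N ∧ r < p x) :
    ∃ q δ, IsPolarFNorm p f q δ := by
  let A : ℝ → Set Z := fun t => closure (f '' {x | p x ≤ t})
  have hA : Monotone A := fun s t hst => closure_mono (Set.image_mono fun v hv => le_trans hv hst)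
  let S : X → Set ℝ := fun x => {t | 0 ≤ t ∧ f x ∈ A t}
  have hSb : ∀ x, BddBelow (S x) := fun x => ⟨0, fun t ht => ht.1⟩
  have hSp : ∀ x, p x ∈ S x := fun x =>
    ⟨hp.nonneg x, subset_closure ⟨x, le_refl (p x), rfl⟩⟩
  let q : X → ℝ := fun x => sInf (S x)
  have hq0 : ∀ x, 0 ≤ q x := fun x => Real.sInf_nonneg fun t ht => ht.1
  have hqle : ∀ x t, 0 ≤ t → f x ∈ A t → q x ≤ t := fun x t ht hx => csInf_le (hSb x) ⟨ht, hx⟩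
  have hqlt : ∀ x t, q x < t → f x ∈ A t := fun x t hx => by
    obtain ⟨s, hs, hst⟩ := (csInf_lt_iff (hSb x) ⟨_, hSp x⟩).1 hx
    exact hA hst.le hs.2
  have hδ : ∃ δ > 0, ∀ N ∈ 𝓝 (0 : Z), ∃ x, f x ∈ N ∧ δ ≤ q x := by
    by_contra! hcon
    obtain ⟨N, hN, hNr⟩ := hp.exists_preimage_subset_of_nearly_open hf hinj (fun s hs => by
      obtain ⟨N, hN, hNs⟩ := hcon s hs
      exact ⟨N, hN, fun x hx => hqlt x s (hNs x hx)⟩) hr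
    obtain ⟨x, hx, hxr⟩ := h N hN
    exact absurd (hNr x hx) hxr.not_ge
  obtain ⟨δ, hδ0, hδ⟩ := hδ
  refine ⟨q, δ, hq0, fun x => csInf_le (hSb x) (hSp x), fun x y => ?_, fun a x ha => ?_,
    fun x hx => ?_, fun x c hc => ?_, hδ0, hδ⟩
  · refine le_of_forall_pos_le_add fun ε hε => ?_
    have hx := hqlt x (q x + ε / 2) (by linarith)
    have hy := hqlt y (q y + ε / 2) (by linarith)
    refine (hqle (x + y) ((q x + ε / 2) + (q y + ε / 2))
      (by linarith [hq0 x, hq0 y]) ?_).trans (by linarith)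
    rw [map_add]
    refine map_mem_closure₂ continuous_add hx hy ?_
    rintro _ ⟨u, hu, rfl⟩ _ ⟨v, hv, rfl⟩
    exact ⟨u + v, (hp.add_le u v).trans (add_le_add hu hv), map_add f u v⟩
  · refine le_of_forall_pos_le_add fun ε hε => ?_
    have hx := hqlt x (q x + ε) (by linarith)
    refine hqle _ _ (by linarith [hq0 x]) ?_
    rw [map_smul]
    refine map_mem_closure (continuous_const_smul a) hx ?_
    rintro _ ⟨u, hu, rfl⟩
    exact ⟨a • u, (hp.smul_le a u ha).trans hu, map_smul f a u⟩
  · refine hinj ((f.map_zero).symm ▸ ?_)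
    by_contra hne
    obtain ⟨t, ht, htN⟩ := hp.exists_closure_image_subset hf
      (isOpen_ne.mem_nhds (Ne.symm hne) : {z : Z | z ≠ f x} ∈ 𝓝 0)
    exact htN (hqlt x t (by rw [hx]; exact ht)) rfl
  · obtain ⟨t, hct, htq⟩ := exists_between hc
    by_cases ht : 0 ≤ t
    · have hxt : f x ∉ A t := fun hx => htq.not_ge (hqle x t ht hx)
      have hN : (fun z => f x + z) ⁻¹' (A t)ᶜ ∈ 𝓝 (0 : Z) :=
        (continuous_const_add (f x)).continuousAt.preimage_mem_nhds
          (isClosed_closure.isOpen_compl.mem_nhds (by simpa using hxt))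
      refine ⟨_, hN, fun y hy => lt_of_not_ge fun hle => hy ?_⟩
      change f x + f y ∈ A t
      rw [← map_add]
      exact hqlt _ _ (hle.trans_lt hct)
    · exact ⟨Set.univ, univ_mem, fun y _ => (hct.trans (not_le.1 ht)).trans_le (hq0 _)⟩

end

/-! ### Basic sequences -/

/-- A sequence which is basic for `q`: the coefficients of a combination of small `q` are bounded,
and the partial sums of a combination with coefficients in the unit disc are controlled by `q`
up to an error that tends to zero. -/
structure IsBasicFor {𝕜 X : Type*} [RCLike 𝕜] [AddCommGroup X] [Module 𝕜 X]
    (q : X → ℝ) (y : ℕ → X) (r : ℝ) : Prop where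
  pos : 0 < r
  norm_lt : ∀ a : ℕ →₀ 𝕜, q (Finsupp.linearCombination 𝕜 y a) < r → ∀ i, ‖a i‖ < 1
  partial_le : ∀ a : ℕ →₀ 𝕜, (∀ i, ‖a i‖ ≤ 1) → ∀ m,
    q (∑ i ∈ Finset.range m, a i • y i) ≤ q (Finsupp.linearCombination 𝕜 y a) + r * (1 / 2) ^ m

theorem Finsupp.exists_linearCombination_eq_sum_range {𝕜 X : Type*} [Semiring 𝕜] [AddCommMonoid X]
    [Module 𝕜 X] (y : ℕ → X) (a : ℕ →₀ 𝕜) :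
    ∃ n, ∀ m, n ≤ m → Finsupp.linearCombination 𝕜 y a = ∑ i ∈ Finset.range m, a i • y i := by
  obtain ⟨n, hn⟩ := a.support.exists_nat_subset_range
  refine ⟨n, fun m hm => ?_⟩
  rw [Finsupp.linearCombination_apply]
  exact Finsupp.sum_of_support_subset _ (hn.trans (Finset.range_mono hm)) _ (by simp)

section

variable {𝕜 X Z : Type*} [RCLike 𝕜] [AddCommGroup X] [Module 𝕜 X]
  [AddCommGroup Z] [Module 𝕜 Z] [TopologicalSpace Z]
  {p q : X → ℝ} {f : X →ₗ[𝕜] Z} {δ : ℝ}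

namespace IsPolarFNorm

theorem map_smul_eq (hq : IsPolarFNorm p f q δ) {a : 𝕜} (ha : ‖a‖ = 1) (x : X) :
    q (a • x) = q x := by
  refine le_antisymm (hq.smul_le a x ha.le) ?_
  have := hq.smul_le a⁻¹ (a • x) (by simp [ha])
  rwa [inv_smul_smul₀ (by rintro rfl; simp at ha)] at this

theorem map_neg (hq : IsPolarFNorm p f q δ) (x : X) : q (-x) = q x := by
  simpa using hq.map_smul_eq (a := -1) (by simp) x

theorem sub_le (hq : IsPolarFNorm p f q δ) (x y : X) : q (x - y) ≤ q x + q y := by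
  simpa [sub_eq_add_neg, hq.map_neg] using hq.add_le x (-y)

theorem le_add_sub (hq : IsPolarFNorm p f q δ) (x y : X) : q x ≤ q y + p (x - y) := by
  have := hq.add_le y (x - y)
  rw [add_sub_cancel] at this
  linarith [hq.le (x - y)]

variable [TopologicalSpace X] [IsTopologicalAddGroup X]

theorem continuous (hq : IsPolarFNorm p f q δ) (hp : IsFNorm 𝕜 p) : Continuous q :=
  hp.continuous_of_le hq.le_add_sub

/-- Lower semicontinuity is uniform on compact sets. -/
theorem exists_le_add_of_isCompact [IsTopologicalAddGroup Z] (hq : IsPolarFNorm p f q δ)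
    (hp : IsFNorm 𝕜 p) (hf : Continuous f) {K : Set X} (hK : IsCompact K) {ε : ℝ} (hε : 0 < ε) :
    ∃ N ∈ 𝓝 (0 : Z), ∀ u ∈ K, ∀ w, f w ∈ N → q u ≤ q (u + w) + ε := by
  refine hK.induction_on (p := fun K => ∃ N ∈ 𝓝 (0 : Z), ∀ u ∈ K, ∀ w, f w ∈ N →
    q u ≤ q (u + w) + ε) ⟨Set.univ, univ_mem, by simp⟩ ?_ ?_ ?_
  · rintro s t hst ⟨N, hN, h⟩
    exact ⟨N, hN, fun u hu => h u (hst hu)⟩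
  · rintro s t ⟨N, hN, h⟩ ⟨N', hN', h'⟩
    refine ⟨N ∩ N', inter_mem hN hN', ?_⟩
    rintro u (hu | hu) w ⟨hw, hw'⟩
    exacts [h u hu w hw, h' u hu w hw']
  · intro x _
    obtain ⟨N, hN, hNx⟩ := hq.lsc x (q x - ε / 2) (by linarith)
    obtain ⟨V, hV, hVN⟩ := exists_nhds_zero_half hN
    have h1 : ∀ᶠ u in 𝓝 x, q u < q x + ε / 2 :=
      ((hq.continuous hp).tendsto x).eventually (gt_mem_nhds (by linarith))
    have h2 : ∀ᶠ u in 𝓝 x, f (u - x) ∈ V := by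
      have : Tendsto (fun u => f (u - x)) (𝓝 x) (𝓝 0) := by
        have h3 : Continuous fun u => f (u - x) := hf.comp (continuous_id.sub continuous_const)
        simpa using h3.tendsto x
      exact this hV
    refine ⟨_, mem_nhdsWithin_of_mem_nhds (h1.and h2), V, hV, fun u hu w hw => ?_⟩
    have h3 := hNx (u - x + w) (by rw [map_add]; exact hVN _ hu.2 _ hw)
    rw [show x + (u - x + w) = u + w by abel] at h3
    linarith [hu.1]

/-- Inductive step in the construction of a basic sequence: the next vector is `q`-large and close
to zero for the weak topology. The thresholds `δ / 6 * (1 + 2⁻ᵐ)` decrease with `m` to make room for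
the errors `δ / 6 * 2⁻⁽ᵐ⁺¹⁾`, and stay above `δ / 6`. -/
theorem exists_next [ContinuousSMul 𝕜 X] [IsTopologicalAddGroup Z] [ContinuousSMul 𝕜 Z]
    (hq : IsPolarFNorm p f q δ) (hp : IsFNorm 𝕜 p) (hf : Continuous f) (m : ℕ) (y : Fin m → X)
    (H : ∀ a : Fin m → 𝕜, q (∑ i, a i • y i) < δ / 6 * (1 + (1 / 2) ^ m) → ∀ i, ‖a i‖ < 1) :
    ∃ z, (∀ (a : Fin m → 𝕜) (t : 𝕜), (∀ i, ‖a i‖ ≤ 1) → ‖t‖ ≤ 1 →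
        q (∑ i, a i • y i) ≤ q (∑ i, a i • y i + t • z) + δ / 6 * (1 / 2) ^ (m + 1)) ∧
      ∀ (a : Fin m → 𝕜) (t : 𝕜), q (∑ i, a i • y i + t • z) < δ / 6 * (1 + (1 / 2) ^ (m + 1)) →
        (∀ i, ‖a i‖ < 1) ∧ ‖t‖ < 1 := by
  have hδ := hq.pos
  have hK : IsCompact ((fun a : Fin m → 𝕜 => ∑ i, a i • y i) '' Metric.closedBall 0 1) :=
    (isCompact_closedBall _ _).image (by fun_prop)
  obtain ⟨N, hN, hNK⟩ := hq.exists_le_add_of_isCompact hp hf hK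
    (ε := δ / 6 * (1 / 2) ^ (m + 1)) (by positivity)
  obtain ⟨V, ⟨hV, hVb⟩, hVN⟩ := (nhds_basis_balanced 𝕜 Z).mem_iff.1 hN
  obtain ⟨z, hzV, hz⟩ := hq.exists_le V hV
  have h1 : ∀ (a : Fin m → 𝕜) (t : 𝕜), ‖a‖ ≤ 1 → ‖t‖ ≤ 1 →
      q (∑ i, a i • y i) ≤ q (∑ i, a i • y i + t • z) + δ / 6 * (1 / 2) ^ (m + 1) := by
    intro a t ha ht
    refine hNK _ ⟨a, by simpa using ha, rfl⟩ _ (hVN ?_)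
    rw [map_smul]
    exact hVb t ht (Set.smul_mem_smul_set hzV)
  refine ⟨z, fun a t ha ht => h1 a t ((pi_norm_le_iff_of_nonneg zero_le_one).2 ha) ht,
    fun a t hat => ?_⟩
  suffices h : max ‖a‖ ‖t‖ < 1 from
    ⟨fun i => (norm_le_pi_norm a i).trans_lt ((le_max_left _ _).trans_lt h),
      (le_max_right _ _).trans_lt h⟩
  by_contra! hM
  -- Rescale such that the largest coefficient has modulus one.
  set M := max ‖a‖ ‖t‖ with hMdef
  have hM0 : 0 < M := one_pos.trans_le hM
  set c : 𝕜 := ((M⁻¹ : ℝ) : 𝕜) with hcdef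
  have hc : ‖c‖ = M⁻¹ := by rw [hcdef, RCLike.norm_ofReal, abs_of_pos (inv_pos.2 hM0)]
  have hc1 : ‖c‖ ≤ 1 := by rw [hc]; exact inv_le_one_of_one_le₀ hM
  have h2 : q (∑ i, (c • a) i • y i + (c * t) • z) < δ / 6 * (1 + (1 / 2) ^ (m + 1)) := by
    have : ∑ i, (c • a) i • y i + (c * t) • z = c • (∑ i, a i • y i + t • z) := by
      simp [smul_add, Finset.smul_sum, smul_smul]
    rw [this]
    exact (hq.smul_le c _ hc1).trans_lt hat
  have hca : ‖c • a‖ ≤ 1 := by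
    rw [norm_smul, hc, inv_mul_le_iff₀ hM0, mul_one]; exact le_max_left _ _
  have hct : ‖c * t‖ ≤ 1 := by
    rw [norm_mul, hc, inv_mul_le_iff₀ hM0, mul_one]; exact le_max_right _ _
  have h3 := h1 (c • a) (c * t) hca hct
  have hpow : (1 / 2 : ℝ) ^ (m + 1) ≤ 1 / 2 := by
    rw [pow_succ]
    linarith [pow_le_one₀ (n := m) (by norm_num : (0 : ℝ) ≤ 1 / 2) (by norm_num)]
  rcases max_choice ‖a‖ ‖t‖ with hmax | hmax
  · have h4 := H (c • a) (by
      have : (1 / 2 : ℝ) ^ m = (1 / 2) ^ (m + 1) + (1 / 2) ^ (m + 1) := by ring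
      rw [this]
      linarith)
    have h5 : ‖c • a‖ < 1 := (pi_norm_lt_iff one_pos).2 h4
    rw [norm_smul, hc, ← hmax, ← hMdef, inv_mul_cancel₀ hM0.ne'] at h5
    exact lt_irrefl _ h5
  -- The new coefficient has modulus one: then `δ ≤ q z` is at most the sum of `q` of the combination
  -- and of its first part, which is less than `δ`.
  · have h4 : ‖c * t‖ = 1 := by
      rw [norm_mul, hc, ← hmax, ← hMdef, inv_mul_cancel₀ hM0.ne']
    have h5 := hq.sub_le (∑ i, (c • a) i • y i + (c * t) • z) (∑ i, (c • a) i • y i)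
    rw [add_sub_cancel_left, hq.map_smul_eq h4] at h5
    nlinarith

theorem exists_isBasicFor [ContinuousSMul 𝕜 X] [IsTopologicalAddGroup Z] [ContinuousSMul 𝕜 Z]
    (hq : IsPolarFNorm p f q δ) (hp : IsFNorm 𝕜 p) (hf : Continuous f) :
    ∃ (y : ℕ → X) (r : ℝ), IsBasicFor (𝕜 := 𝕜) q y r := by
  have hδ := hq.pos
  have hF : ∀ (m : ℕ) (y : Fin m → X), ∃ z,
      (∀ a : Fin m → 𝕜, q (∑ i, a i • y i) < δ / 6 * (1 + (1 / 2) ^ m) → ∀ i, ‖a i‖ < 1) →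
      (∀ (a : Fin m → 𝕜) (t : 𝕜), (∀ i, ‖a i‖ ≤ 1) → ‖t‖ ≤ 1 →
        q (∑ i, a i • y i) ≤ q (∑ i, a i • y i + t • z) + δ / 6 * (1 / 2) ^ (m + 1)) ∧
      ∀ (a : Fin m → 𝕜) (t : 𝕜), q (∑ i, a i • y i + t • z) < δ / 6 * (1 + (1 / 2) ^ (m + 1)) →
        (∀ i, ‖a i‖ < 1) ∧ ‖t‖ < 1 := by
    intro m y
    by_cases H : ∀ a : Fin m → 𝕜, q (∑ i, a i • y i) < δ / 6 * (1 + (1 / 2) ^ m) → ∀ i, ‖a i‖ < 1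
    · obtain ⟨z, hz⟩ := hq.exists_next hp hf m y H
      exact ⟨z, fun _ => hz⟩
    · exact ⟨0, fun h => absurd h H⟩
  choose F hF using hF
  obtain ⟨y, hy⟩ := exists_seq_of_prefix F
  have hH : ∀ (m : ℕ) (a : Fin m → 𝕜),
      q (∑ i, a i • y i) < δ / 6 * (1 + (1 / 2) ^ m) → ∀ i, ‖a i‖ < 1 := by
    intro m
    induction m with
    | zero => exact fun a _ i => i.elim0
    | succ m ih =>
      intro a ha
      rw [Fin.sum_univ_castSucc] at ha
      simp only [Fin.val_castSucc, Fin.val_last] at ha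
      rw [hy m] at ha
      obtain ⟨h1, h2⟩ := (hF m _ ih).2 (fun i => a i.castSucc) _ ha
      exact Fin.lastCases h2 h1
  have hstep : ∀ (a : ℕ → 𝕜), (∀ i, ‖a i‖ ≤ 1) → ∀ m,
      q (∑ i ∈ Finset.range m, a i • y i) ≤
        q (∑ i ∈ Finset.range (m + 1), a i • y i) + δ / 6 * (1 / 2) ^ (m + 1) := by
    intro a ha m
    have := (hF m _ (hH m)).1 (fun i => a i) (a m) (fun i => ha i) (ha m)
    rwa [← hy m, Fin.sum_univ_eq_sum_range (fun i => a i • y i), ← Finset.sum_range_succ] at this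
  have hchain : ∀ (a : ℕ → 𝕜), (∀ i, ‖a i‖ ≤ 1) → ∀ m k,
      q (∑ i ∈ Finset.range m, a i • y i) ≤ q (∑ i ∈ Finset.range (m + k), a i • y i) +
        δ / 6 * ((1 / 2) ^ m - (1 / 2) ^ (m + k)) := by
    intro a ha m k
    induction k with
    | zero => simp
    | succ k ih =>
      have := hstep a ha (m + k)
      rw [← add_assoc]
      have h2 : (1 / 2 : ℝ) ^ (m + k) = (1 / 2) ^ (m + k + 1) + (1 / 2) ^ (m + k + 1) := by ring
      rw [h2] at ih
      linarith
  refine ⟨y, δ / 6, by positivity, fun a ha i => ?_, fun a ha m => ?_⟩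
  · obtain ⟨n, hn⟩ := a.exists_linearCombination_eq_sum_range y
    have h1 := hn (n + i + 1) (by omega)
    rw [h1, ← Fin.sum_univ_eq_sum_range (fun i => a i • y i)] at ha
    exact hH (n + i + 1) (fun i => a i) (ha.trans_le (by
      have : (0 : ℝ) < (1 / 2) ^ (n + i + 1) := by positivity
      nlinarith)) ⟨i, by omega⟩
  · obtain ⟨n, hn⟩ := a.exists_linearCombination_eq_sum_range y
    rw [hn (m + n) (by omega)]
    refine (hchain a ha m n).trans ?_
    have : (0 : ℝ) < (1 / 2) ^ (m + n) := by positivity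
    nlinarith

/-- A vector in the closed span of a basic sequence vanishes if its coefficients do. -/
theorem eq_zero_of_tendsto [ContinuousSMul 𝕜 X] (hq : IsPolarFNorm p f q δ) (hp : IsFNorm 𝕜 p)
    {y : ℕ → X} {r : ℝ} (hy : IsBasicFor (𝕜 := 𝕜) q y r) {a : ℕ → ℕ →₀ 𝕜} {v : X}
    (hv : Tendsto (fun k => Finsupp.linearCombination 𝕜 y (a k)) atTop (𝓝 v))
    (ha : ∀ i, Tendsto (fun k => a k i) atTop (𝓝 0)) : v = 0 := by
  apply hq.eq_zero
  have hqc := hq.continuous hp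
  have h0 : q 0 = 0 := le_antisymm ((hq.le 0).trans hp.map_zero.le) (hq.nonneg 0)
  refine le_antisymm (le_of_forall_pos_le_add fun η hη => ?_) (hq.nonneg v)
  rw [zero_add]
  have hη' : 0 < min η r := lt_min hη hy.pos
  have hcau : ∀ᶠ ij : ℕ × ℕ in atTop ×ˢ atTop, q (Finsupp.linearCombination 𝕜 y (a ij.1) -
      Finsupp.linearCombination 𝕜 y (a ij.2)) < min η r := by
    have h1 : Tendsto (fun ij : ℕ × ℕ => Finsupp.linearCombination 𝕜 y (a ij.1) -
        Finsupp.linearCombination 𝕜 y (a ij.2)) (atTop ×ˢ atTop) (𝓝 0) := by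
      simpa using (hv.comp tendsto_fst).sub (hv.comp tendsto_snd)
    have h2 := (hqc.tendsto 0).comp h1
    rw [h0] at h2
    exact h2.eventually (gt_mem_nhds hη')
  rw [prod_atTop_atTop_eq, eventually_atTop_prod_self] at hcau
  obtain ⟨K, hK⟩ := hcau
  refine le_of_tendsto ((hqc.tendsto v).comp hv) ((eventually_ge_atTop K).mono fun j hj => ?_)
  have hm : ∀ᶠ m in atTop, q (Finsupp.linearCombination 𝕜 y (a j)) ≤ η + r * (1 / 2) ^ m := by
    obtain ⟨n, hn⟩ := (a j).exists_linearCombination_eq_sum_range y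
    refine (eventually_ge_atTop n).mono fun m hm => ?_
    have h1 : Tendsto (fun i => q (∑ l ∈ Finset.range m, (a j - a i) l • y l)) atTop
        (𝓝 (q (Finsupp.linearCombination 𝕜 y (a j)))) := by
      refine (hqc.tendsto _).comp ?_
      rw [hn m hm]
      refine tendsto_finsetSum _ fun l _ => ?_
      simpa using (tendsto_const_nhds.sub (ha l)).smul_const (y l)
    refine le_of_tendsto h1 ((eventually_ge_atTop K).mono fun i hi => ?_)
    have h2 : q (Finsupp.linearCombination 𝕜 y (a j) - Finsupp.linearCombination 𝕜 y (a i)) <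
        min η r := hK j i hj hi
    rw [← map_sub] at h2
    have h3 := hy.partial_le (a j - a i)
      (fun l => (hy.norm_lt _ (h2.trans_le (min_le_right _ _)) l).le) m
    linarith [h2.trans_le (min_le_left _ _)]
  have h2 : Tendsto (fun m : ℕ => η + r * (1 / 2 : ℝ) ^ m) atTop (𝓝 (η + r * 0)) :=
    tendsto_const_nhds.add ((tendsto_pow_atTop_nhds_zero_of_lt_one (by norm_num)
      (by norm_num)).const_mul r)
  simpa using ge_of_tendsto h2 hm

end IsPolarFNorm

end

/-! ### Closed subspaces that avoid `W` -/

section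

variable {𝕜 E : Type*} [RCLike 𝕜] [AddCommGroup E] [Module 𝕜 E] [TopologicalSpace E] {p : E → ℝ}

theorem Finsupp.seriesConvergesTo_linearCombination (x : ℕ → E) (a : ℕ →₀ 𝕜) :
    SeriesConvergesTo a x (Finsupp.linearCombination 𝕜 x a) := by
  obtain ⟨n, hn⟩ := a.exists_linearCombination_eq_sum_range x
  exact tendsto_const_nhds.congr' ((eventually_ge_atTop n).mono fun m hm => hn m hm)

/-- On the unit ball of `ℓ_∞` with the topology of pointwise convergence, the sum of a series
`∑ cₙ xₙ` with `∑ p (xₙ) < ∞` depends continuously on the coefficients. -/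
theorem IsFNorm.tendsto_of_seriesConvergesTo [IsTopologicalAddGroup E] [ContinuousSMul 𝕜 E]
    (hp : IsFNorm 𝕜 p) {x : ℕ → E} (hx : Summable fun n => p (x n))
    {c : ℕ → ℕ → 𝕜} {b : ℕ → 𝕜} (hc : ∀ k i, ‖c k i‖ ≤ 1) (hb : ∀ i, ‖b i‖ ≤ 1)
    (hcb : ∀ i, Tendsto (fun k => c k i) atTop (𝓝 (b i))) {s : ℕ → E} {t : E}
    (hs : ∀ k, SeriesConvergesTo (c k) x (s k)) (ht : SeriesConvergesTo b x t) :
    Tendsto s atTop (𝓝 t) := by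
  rw [hp.tendsto_iff]
  have hbound : ∀ k i, p ((c k - b) i • x i) ≤ 2 * p (x i) := fun k i => by
    rw [Pi.sub_apply, sub_smul]
    linarith [hp.sub_le (c k i • x i) (b i • x i), hp.smul_le _ (x i) (hc k i),
      hp.smul_le _ (x i) (hb i)]
  have hsum : Summable fun i => 2 * p (x i) := hx.mul_left 2
  have h0 : Tendsto (fun k => ∑' i, p ((c k - b) i • x i)) atTop (𝓝 (∑' _ : ℕ, (0 : ℝ))) := by
    refine tendsto_tsum_of_dominated_convergence hsum (fun i => ?_)
      (Eventually.of_forall fun k i => ?_)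
    · refine hp.tendsto_zero_iff.1 ?_
      simpa using ((hcb i).sub_const (b i)).smul_const (x i)
    · rw [Real.norm_of_nonneg (hp.nonneg _)]
      exact hbound k i
  rw [tsum_zero] at h0
  refine squeeze_zero (fun _ => hp.nonneg _) (fun k => ?_) h0
  exact hp.le_tsum (hsum.of_nonneg_of_le (fun _ => hp.nonneg _) (hbound k)) ((hs k).sub ht)

/-- The number `max 1 ‖a‖_∞`, which is attained unless it is `1`. -/
theorem Finsupp.exists_max_norm (a : ℕ →₀ 𝕜) :
    ∃ M : ℝ, 1 ≤ M ∧ (∀ i, ‖a i‖ ≤ M) ∧ (M = 1 ∨ ∃ i, ‖a i‖ = M) := by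
  by_cases h : ∀ i, ‖a i‖ ≤ 1
  · exact ⟨1, le_rfl, h, Or.inl rfl⟩
  push Not at h
  obtain ⟨j, hj⟩ := h
  have hjs : j ∈ a.support := Finsupp.mem_support_iff.2 fun h => by
    rw [h, norm_zero] at hj; linarith
  obtain ⟨i, -, hmax⟩ := a.support.exists_max_image (fun i => ‖a i‖) ⟨j, hjs⟩
  refine ⟨‖a i‖, hj.le.trans (hmax j hjs), fun k => ?_, Or.inr ⟨i, rfl⟩⟩
  by_cases hk : k ∈ a.support
  · exact hmax k hk
  · rw [Finsupp.notMem_support_iff.1 hk, norm_zero]; exact norm_nonneg _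

theorem IsBoundedlyFree.linearIndependent_add [ContinuousSMul 𝕜 E] {Y W : Submodule 𝕜 E}
    (hYW : Y ≤ W) {y : ℕ → Y} {x : ℕ → E} (hx : IsBoundedlyFree p x W) :
    LinearIndependent 𝕜 fun n => (y n : E) + x n := by
  rw [linearIndependent_iff]
  intro a ha
  have h1 : (Finsupp.linearCombination 𝕜 y a : E) + Finsupp.linearCombination 𝕜 x a = 0 := by
    rw [← ha, ← Y.subtype_apply, Finsupp.apply_linearCombination]
    simp [Finsupp.linearCombination_apply, Finsupp.sum_add]
  have h2 : Finsupp.linearCombination 𝕜 x a ∈ W := by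
    rw [← neg_eq_of_add_eq_zero_right h1]
    exact W.neg_mem (hYW (_ : Y).2)
  obtain ⟨M, -, hM, -⟩ := a.exists_max_norm
  have := hx.eq_zero_of_bounded hM h2 (Finsupp.seriesConvergesTo_linearCombination x a)
  exact DFunLike.coe_injective this

variable [IsTopologicalAddGroup E] [ContinuousSMul 𝕜 E] [T2Space E]
  {Z : Type*} [AddCommGroup Z] [Module 𝕜 Z] [TopologicalSpace Z]
  {Y W : Submodule 𝕜 E} {f : Y →ₗ[𝕜] Z} {q : Y → ℝ} {δ r : ℝ} {y : ℕ → Y} {x : ℕ → E}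

/-- Perturbing a basic sequence of a closed subspace `Y ≤ W` by a sequence that is boundedly free
modulo `W` gives a closed subspace that meets `W` only at the origin. The perturbation
`∑ aₙ yₙ ↦ ∑ aₙ xₙ` is compact, so limits of `∑ aₙ (yₙ + xₙ)` can be computed along subsequences with
pointwise convergent, normalized coefficients. -/
theorem IsBasicFor.eq_zero_of_mem_closure (hp : IsFNorm 𝕜 p) (hYW : Y ≤ W)
    (hY : IsClosed (Y : Set E)) (hq : IsPolarFNorm (fun v : Y => p v) f q δ)
    (hy : IsBasicFor (𝕜 := 𝕜) q y r) (hx : IsBoundedlyFree p x W) {g : E}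
    (hg : g ∈ (Submodule.span 𝕜 (Set.range fun n => (y n : E) + x n)).topologicalClosure)
    (hgW : g ∈ W) : g = 0 := by
  have := hp.firstCountable
  have hpY := hp.restrict Y hY
  obtain ⟨u, hu, hug⟩ := mem_closure_iff_seq_limit.1 hg
  have hu' : ∀ k, ∃ a : ℕ →₀ 𝕜, (Finsupp.linearCombination 𝕜 y a : E) +
      Finsupp.linearCombination 𝕜 x a = u k := fun k => by
    obtain ⟨a, ha⟩ := (Finsupp.mem_span_range_iff_exists_finsupp).1 (hu k)
    refine ⟨a, ?_⟩
    rw [← ha, ← Y.subtype_apply, Finsupp.apply_linearCombination]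
    simp [Finsupp.linearCombination_apply, Finsupp.sum_add]
  choose a ha using hu'
  choose M hM1 hMa hM using fun k => (a k).exists_max_norm
  have hM0 : ∀ k, 0 < M k := fun k => one_pos.trans_le (hM1 k)
  -- The normalized coefficients `b k` lie in a compact product of discs.
  let t : ℕ → ℝ := fun k => (M k)⁻¹
  have ht0 : ∀ k, 0 < t k := fun k => inv_pos.2 (hM0 k)
  let b : ℕ → ℕ →₀ 𝕜 := fun k => (t k : 𝕜) • a k
  have hbn : ∀ k i, ‖b k i‖ = t k * ‖a k i‖ := fun k i => by
    rw [Finsupp.smul_apply, norm_smul, RCLike.norm_ofReal, abs_of_pos (ht0 k)]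
  have hb : ∀ k i, ‖b k i‖ ≤ 1 := fun k i => by
    rw [hbn, inv_mul_le_iff₀ (hM0 k), mul_one]; exact hMa k i
  have hcomp : IsCompact (Set.Icc (0 : ℝ) 1 ×ˢ
      Set.univ.pi fun _ : ℕ => Metric.closedBall (0 : 𝕜) 1) :=
    isCompact_Icc.prod (isCompact_univ_pi fun _ => isCompact_closedBall _ _)
  obtain ⟨⟨τ, β⟩, hτβ, φ, hφ, hlim⟩ := hcomp.tendsto_subseq
    (x := fun k => ((t k, fun i => b k i) : ℝ × (ℕ → 𝕜))) fun k =>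
      ⟨⟨(ht0 k).le, inv_le_one_of_one_le₀ (hM1 k)⟩, fun i _ => by simpa using hb k i⟩
  have hτ : Tendsto (fun k => t (φ k)) atTop (𝓝 τ) := (continuous_fst.tendsto _).comp hlim
  have hβ : ∀ i, Tendsto (fun k => b (φ k) i) atTop (𝓝 (β i)) := fun i =>
    (((continuous_apply i).comp continuous_snd).tendsto _).comp hlim
  have hβ1 : ∀ i, ‖β i‖ ≤ 1 := fun i => by simpa using hτβ.2 i (Set.mem_univ i)
  obtain ⟨s, hs⟩ := hp.exists_seriesConvergesTo hx.summable hβ1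
  have hxs : Tendsto (fun k => Finsupp.linearCombination 𝕜 x (b (φ k))) atTop (𝓝 s) :=
    hp.tendsto_of_seriesConvergesTo hx.summable (fun k => hb (φ k)) hβ1 hβ
      (fun k => Finsupp.seriesConvergesTo_linearCombination x _) hs
  have htu : Tendsto (fun k => (t (φ k) : 𝕜) • u (φ k)) atTop (𝓝 ((τ : 𝕜) • g)) :=
    (((RCLike.continuous_ofReal (K := 𝕜)).tendsto τ).comp hτ).smul (hug.comp hφ.tendsto_atTop)
  have hys : Tendsto (fun k => (Finsupp.linearCombination 𝕜 y (b (φ k)) : E)) atTop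
      (𝓝 ((τ : 𝕜) • g - s)) := by
    refine (htu.sub hxs).congr fun k => ?_
    rw [← ha, smul_add]
    simp only [b, map_smul, Submodule.coe_smul, add_sub_cancel_right]
  have hsY : (τ : 𝕜) • g - s ∈ Y := hY.mem_of_tendsto hys (Eventually.of_forall fun k => (_ : Y).2)
  have hsW : s ∈ W := by
    have := W.sub_mem (W.smul_mem (τ : 𝕜) hgW) (hYW hsY)
    rwa [sub_sub_cancel] at this
  have hβ0 : β = 0 := hx.eq_zero β hβ1 s hsW hs
  have hs0 : s = 0 := by
    subst hβ0
    exact tendsto_nhds_unique hs (by simp)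
  subst hs0
  have hyY : Tendsto (fun k => Finsupp.linearCombination 𝕜 y (b (φ k))) atTop
      (𝓝 ⟨(τ : 𝕜) • g - 0, hsY⟩) := tendsto_subtype_rng.2 hys
  have hv0 := hq.eq_zero_of_tendsto hpY hy hyY (fun i => by simpa [hβ0] using hβ i)
  rw [hv0] at hyY
  have hτg : (τ : 𝕜) • g = 0 := by simpa using congrArg Subtype.val hv0
  refine (smul_eq_zero.1 hτg).resolve_left fun hτ0 => ?_
  rw [RCLike.ofReal_eq_zero] at hτ0
  subst hτ0
  -- Eventually `M k > 1`, so some normalized coefficient has modulus one; this is impossible for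
  -- a combination of small `q`.
  have h1 : ∀ᶠ k in atTop, q (Finsupp.linearCombination 𝕜 y (b (φ k))) < r := by
    have h2 := ((hq.continuous hpY).tendsto 0).comp hyY
    have h0 : q 0 = 0 := le_antisymm ((hq.le 0).trans hpY.map_zero.le) (hq.nonneg 0)
    rw [h0] at h2
    exact h2.eventually (gt_mem_nhds hy.pos)
  obtain ⟨k, hk, hkt⟩ := (h1.and (hτ.eventually (gt_mem_nhds one_pos))).exists
  rcases hM (φ k) with hM' | ⟨i, hi⟩
  · simp [t, hM'] at hkt
  · have h2 := hy.norm_lt _ hk i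
    rw [hbn, hi, inv_mul_cancel₀ (hM0 _).ne'] at h2
    exact lt_irrefl _ h2

end

/-! ### Dimension of closed spans -/

section Rank

universe u

variable {𝕜 : Type*} {E : Type u} [RCLike 𝕜] [AddCommGroup E] [Module 𝕜 E]

theorem exists_linearIndependent_nat {V : Type*} [AddCommGroup V] [Module 𝕜 V]
    (h : ¬ FiniteDimensional 𝕜 V) : ∃ v : ℕ → V, LinearIndependent 𝕜 v := by
  let b := Module.Basis.ofVectorSpace 𝕜 V
  have : Infinite (Module.Basis.ofVectorSpaceIndex 𝕜 V) := by
    rw [← not_finite_iff_infinite]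
    exact fun _ => h (Module.Finite.of_basis b)
  exact ⟨_, b.linearIndependent.comp _ (Infinite.natEmbedding _).injective⟩

variable [TopologicalSpace E]

theorem SeriesConvergesTo.sum [IsTopologicalAddGroup E] {ι : Type*} {s : Finset ι}
    {c : ι → ℕ → 𝕜} {x : ℕ → E} {v : ι → E} (h : ∀ i ∈ s, SeriesConvergesTo (c i) x (v i)) :
    SeriesConvergesTo (∑ i ∈ s, c i) x (∑ i ∈ s, v i) := by
  refine (tendsto_finsetSum s h).congr fun N => ?_
  rw [Finset.sum_comm]
  simp [Finset.sum_smul]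

/-- Geometric sequences with different ratios are eigenvectors of the shift with different
eigenvalues. -/
theorem linearIndependent_geometric (𝕜 : Type*) [RCLike 𝕜] :
    LinearIndependent 𝕜 fun (ρ : Set.Ioo (0 : ℝ) 1) (n : ℕ) => ((ρ : ℝ) : 𝕜) ^ n := by
  let S : Module.End 𝕜 (ℕ → 𝕜) := LinearMap.funLeft 𝕜 𝕜 Nat.succ
  refine S.eigenvectors_linearIndependent' (fun ρ : Set.Ioo (0 : ℝ) 1 => ((ρ : ℝ) : 𝕜))
    (fun ρ σ h => Subtype.ext (RCLike.ofReal_injective h)) _ fun ρ => ⟨?_, ?_⟩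
  · rw [Module.End.mem_eigenspace_iff]
    funext n
    simp [S, LinearMap.funLeft, pow_succ']
  · intro h
    simpa using congrFun h 0

variable [IsTopologicalAddGroup E] [ContinuousSMul 𝕜 E] [T2Space E] {p : E → ℝ}

/-- The sums `∑ ρⁿ xₙ`, `0 < ρ < 1`, of a boundedly free sequence are linearly independent. -/
theorem IsFNorm.continuum_le_rank (hp : IsFNorm 𝕜 p) {G : Submodule 𝕜 E}
    (hG : IsClosed (G : Set E)) {z : ℕ → E} (hz : LinearIndependent 𝕜 z) (hzG : ∀ n, z n ∈ G) :
    𝔠 ≤ Module.rank 𝕜 G := by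
  have hbot : IsClosed ((⊥ : Submodule 𝕜 E) : Set E) := by simp
  obtain ⟨a, ha⟩ := hp.exists_isBoundedlyFree hbot
    (hz.map' (⊥ : Submodule 𝕜 E).mkQ (Submodule.ker_mkQ _))
  have h1 : ∀ ρ : Set.Ioo (0 : ℝ) 1, ∀ n, ‖((ρ : ℝ) : 𝕜) ^ n‖ ≤ 1 := fun ρ n => by
    rw [norm_pow, RCLike.norm_ofReal, abs_of_pos ρ.2.1]
    exact pow_le_one₀ ρ.2.1.le ρ.2.2.le
  choose v hv using fun ρ => hp.exists_seriesConvergesTo ha.summable (h1 ρ)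
  have hvG : ∀ ρ, v ρ ∈ G := fun ρ => hG.mem_of_tendsto (hv ρ) (Eventually.of_forall fun N =>
    G.sum_mem fun i _ => G.smul_mem _ (G.smul_mem _ (hzG i)))
  have hind : LinearIndependent 𝕜 fun ρ => (⟨v ρ, hvG ρ⟩ : G) := by
    rw [linearIndependent_iff']
    intro s l hl
    refine linearIndependent_iff'.1 (linearIndependent_geometric 𝕜) s l ?_
    refine ha.eq_zero_of_bounded (M := ∑ ρ ∈ s, ‖l ρ‖) (fun n => ?_) (s := 0) (zero_mem _) ?_
    · rw [Finset.sum_apply]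
      refine (norm_sum_le _ _).trans (Finset.sum_le_sum fun ρ _ => ?_)
      rw [Pi.smul_apply, norm_smul]
      exact mul_le_of_le_one_right (norm_nonneg _) (h1 ρ n)
    · have h0 : ∑ ρ ∈ s, l ρ • v ρ = 0 := by simpa using congrArg Subtype.val hl
      rw [← h0]
      exact SeriesConvergesTo.sum fun ρ _ => (hv ρ).smul (l ρ)
  have := hind.cardinal_lift_le_rank
  rwa [Cardinal.mk_Ioo_real one_pos, Cardinal.lift_continuum, Cardinal.lift_id'.{0, u}] at this

/-- A closed span of a sequence has at most `𝔠` elements, each being the limit of a sequence of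
finite combinations. -/
theorem rank_closure_span_le_continuum [FirstCountableTopology E] (z : ℕ → E) :
    Module.rank 𝕜 (Submodule.span 𝕜 (Set.range z)).topologicalClosure ≤ 𝔠 := by
  refine (rank_le_card 𝕜 _).trans ?_
  have h : ∀ g : (Submodule.span 𝕜 (Set.range z)).topologicalClosure, ∃ a : ℕ → ℕ →₀ 𝕜,
      Tendsto (fun k => Finsupp.linearCombination 𝕜 z (a k)) atTop (𝓝 (g : E)) := fun g => by
    obtain ⟨u, hu, hug⟩ := mem_closure_iff_seq_limit.1 g.2
    choose a ha using fun k => (Finsupp.mem_span_range_iff_exists_finsupp).1 (hu k)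
    refine ⟨a, ?_⟩
    simpa [Finsupp.linearCombination_apply, ha] using hug
  choose a ha using h
  let Φ : (Submodule.span 𝕜 (Set.range z)).topologicalClosure → ℕ → ℕ → ℝ × ℝ :=
    fun g k n => (RCLike.re (a g k n), RCLike.im (a g k n))
  have hΦ : Function.Injective Φ := by
    intro g g' hgg
    have : a g = a g' := by
      funext k
      ext n
      have h1 := congrFun (congrFun hgg k) n
      exact RCLike.ext (congrArg Prod.fst h1) (congrArg Prod.snd h1)
    have h1 := ha g
    rw [this] at h1
    exact Subtype.ext (tendsto_nhds_unique h1 (ha g'))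
  have hcard : #(ℕ → ℕ → ℝ × ℝ) = 𝔠 := by simp [Cardinal.mk_real]
  have := Cardinal.lift_mk_le_lift_mk_of_injective hΦ
  rwa [hcard, Cardinal.lift_continuum, Cardinal.lift_id'.{0, u}] at this

end Rank

/-! ### The equivalence -/

section

universe u

variable {𝕜 : Type*} {E : Type u} [RCLike 𝕜] [AddCommGroup E] [Module 𝕜 E]

theorem subset_compl_union_zero_iff {F W : Submodule 𝕜 E} :
    (F : Set E) ⊆ (W : Set E)ᶜ ∪ {0} ↔ ∀ g ∈ F, g ∈ W → g = 0 := by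
  refine forall₂_congr fun g _ => ?_
  rw [Set.mem_union, Set.mem_compl_iff, Set.mem_singleton_iff, SetLike.mem_coe]
  tauto

theorem Submodule.exists_le_rank_eq (F : Submodule 𝕜 E) (h : ℵ₀ ≤ Module.rank 𝕜 F) (n : ℕ) :
    ∃ F' ≤ F, Module.rank 𝕜 F' = n := by
  obtain ⟨v, hv⟩ := Module.le_rank_iff.1 ((Cardinal.natCast_lt_aleph0 (n := n)).le.trans h)
  have hv' : LinearIndependent 𝕜 fun i => (v i : E) := hv.map' F.subtype (Submodule.ker_subtype _)
  refine ⟨Submodule.span 𝕜 (Set.range fun i => (v i : E)), ?_, ?_⟩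
  · rw [Submodule.span_le]
    rintro _ ⟨i, rfl⟩
    exact (v i).2
  · have : FiniteDimensional 𝕜 (Submodule.span 𝕜 (Set.range fun i => (v i : E))) :=
      FiniteDimensional.span_of_finite 𝕜 (Set.finite_range _)
    rw [← Module.finrank_eq_rank, finrank_span_eq_card hv', Fintype.card_fin]

variable [TopologicalSpace E] [ContinuousSMul 𝕜 E] [T2Space E] {p : E → ℝ}

/-- A lineable system for a sequence space containing `c₀` becomes boundedly free when it is scaled by
a null sequence: the scaling takes bounded sequences to null sequences. -/
theorem IsFNorm.exists_isBoundedlyFree_of_seqLineable (hp : IsFNorm 𝕜 p) {W : Submodule 𝕜 E}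
    {S : Submodule 𝕜 (lp (fun _ : ℕ => 𝕜) ∞)}
    (hS : ∀ c : lp (fun _ : ℕ => 𝕜) ∞, Tendsto (fun n => c n) atTop (𝓝 0) → c ∈ S) {x : ℕ → E}
    (hind : SeqIndependent x (S.map (linftyToSeq 𝕜)))
    (hlin : SeqLineable x (S.map (linftyToSeq 𝕜)) (W : Set E)ᶜ) :
    ∃ y : ℕ → E, IsBoundedlyFree p y W := by
  choose a ha0 ha hax using fun n : ℕ =>
    hp.exists_smul_le (x n) (r := (1 / 2) ^ n) (by positivity)
  refine ⟨fun n => a n • x n,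
    summable_geometric_two.of_nonneg_of_le (fun _ => hp.nonneg _) fun n => (hax n).le,
    fun c hc s hs hcs => ?_⟩
  have hca : ∀ n, ‖c n * a n‖ ≤ (1 / 2) ^ n := fun n => by
    rw [norm_mul]
    exact (mul_le_of_le_one_left (norm_nonneg _) (hc n)).trans (ha n)
  have hmem : Memℓp (E := fun _ : ℕ => 𝕜) (fun n => c n * a n) ∞ := by
    refine memℓp_infty ⟨1, ?_⟩
    rintro _ ⟨n, rfl⟩
    exact (hca n).trans (pow_le_one₀ (by norm_num) (by norm_num))
  have hmap : (fun n => c n * a n) ∈ S.map (linftyToSeq 𝕜) := by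
    refine ⟨⟨_, hmem⟩, hS _ ?_, rfl⟩
    exact squeeze_zero_norm hca (tendsto_pow_atTop_nhds_zero_of_lt_one (by norm_num) (by norm_num))
  have hcs' : SeriesConvergesTo (fun n => c n * a n) x s := by
    simpa [SeriesConvergesTo, smul_smul] using hcs
  obtain ⟨s', hs', hcs''⟩ := hlin _ hmap
  have hss : s' = s := tendsto_nhds_unique hcs'' hcs'
  subst hss
  have hs0 : s' = 0 := hs'.resolve_left fun h => h hs
  subst hs0
  have := hind _ hmap hcs'
  funext n
  exact (mul_eq_zero.1 (congrFun this n)).resolve_right (ha0 n)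

theorem IsBoundedlyFree.seqIndependent_and_seqLineable (hp : IsFNorm 𝕜 p) {W : Submodule 𝕜 E}
    {x : ℕ → E} (hx : IsBoundedlyFree p x W) :
    SeqIndependent x ((⊤ : Submodule 𝕜 (lp (fun _ : ℕ => 𝕜) ∞)).map (linftyToSeq 𝕜)) ∧
      SeqLineable x ((⊤ : Submodule 𝕜 (lp (fun _ : ℕ => 𝕜) ∞)).map (linftyToSeq 𝕜))
        (W : Set E)ᶜ := by
  have hb : ∀ (c : lp (fun _ : ℕ => 𝕜) ∞) n, ‖linftyToSeq 𝕜 c n‖ ≤ ‖c‖ := fun c n =>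
    lp.norm_apply_le_norm ENNReal.top_ne_zero c n
  constructor
  · rintro _ ⟨c, -, rfl⟩ hc
    exact hx.eq_zero_of_bounded (hb c) (zero_mem W) hc
  · rintro _ ⟨c, -, rfl⟩
    obtain ⟨s, hs⟩ := IsFNorm.exists_seriesConvergesTo_of_bounded hp hx.summable (hb c)
    refine ⟨s, ?_, hs⟩
    by_cases hsW : s ∈ W
    · have h0 := hx.eq_zero_of_bounded (hb c) hsW hs
      rw [h0] at hs
      exact Or.inr (tendsto_nhds_unique hs (by simp))
    · exact Or.inl hsW

variable [IsTopologicalAddGroup E]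

/-- The closed infinite-dimensional subspace obtained by perturbing a basic sequence of a closed
subspace `Y ≤ W` on which there is a continuous injection that is not an embedding. -/
theorem IsBoundedlyFree.exists_closed_of_injection {Z : Type*} [AddCommGroup Z] [Module 𝕜 Z]
    [TopologicalSpace Z] [IsTopologicalAddGroup Z] [ContinuousSMul 𝕜 Z] [T2Space Z]
    (hp : IsFNorm 𝕜 p) {Y W : Submodule 𝕜 E} (hYW : Y ≤ W) (hY : IsClosed (Y : Set E))
    {f : Y →ₗ[𝕜] Z} (hf : Continuous f) (hinj : Function.Injective f) {r : ℝ} (hr : 0 < r)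
    (h : ∀ N ∈ 𝓝 (0 : Z), ∃ v, f v ∈ N ∧ r < p v) {x : ℕ → E} (hx : IsBoundedlyFree p x W) :
    ∃ z : ℕ → E, LinearIndependent 𝕜 z ∧
      ∀ g ∈ (Submodule.span 𝕜 (Set.range z)).topologicalClosure, g ∈ W → g = 0 := by
  have hpY := hp.restrict Y hY
  obtain ⟨q, δ, hq⟩ := hpY.exists_isPolarFNorm hf hinj hr h
  obtain ⟨y, s, hy⟩ := hq.exists_isBasicFor hpY hf
  exact ⟨_, hx.linearIndependent_add hYW, fun g hg hgW =>
    hy.eq_zero_of_mem_closure hp hYW hY hq hx hg hgW⟩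

theorem IsBoundedlyFree.exists_closed (hp : IsFNorm 𝕜 p) {Y W : Submodule 𝕜 E} (hYW : Y ≤ W)
    (hY : IsClosed (Y : Set E)) (hmin : ¬ IsMinimalTVS 𝕜 Y) {x : ℕ → E}
    (hx : IsBoundedlyFree p x W) :
    ∃ z : ℕ → E, LinearIndependent 𝕜 z ∧
      ∀ g ∈ (Submodule.span 𝕜 (Set.range z)).topologicalClosure, g ∈ W → g = 0 := by
  have hbasis := (hp.restrict Y hY).basis
  obtain ⟨σ, hσ, hT2, hG, hS⟩ := not_not.1 hmin
  have hr : ∃ r > 0, ∀ N ∈ @nhds Y σ 0, ∃ v : Y, v ∈ N ∧ r < p v := by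
    by_contra! hcon
    refine hσ.not_ge ?_
    rw [← continuous_id_iff_le]
    refine @continuous_of_tendsto_nhds_zero Y σ _ hG Y (Y →+ Y) _ instTopologicalSpaceSubtype _ _ _
      (AddMonoidHom.id Y) ?_
    refine hbasis.tendsto_right_iff.2 fun r hr => ?_
    obtain ⟨N, hN, hNr⟩ := hcon (r / 2) (half_pos hr)
    exact mem_of_superset hN fun v hv => (hNr v hv).trans_lt (half_lt_self hr)
  obtain ⟨r, hr, h⟩ := hr
  -- The injection is the identity of `Y`, with the weaker topology `σ` on its codomain.
  exact @IsBoundedlyFree.exists_closed_of_injection 𝕜 E _ _ _ _ _ _ p _ Y _ _ σ hG hS hT2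
    hp Y W hYW hY LinearMap.id (continuous_id_iff_le.2 hσ.le) Function.injective_id r hr h x hx

/-- A closed infinite-dimensional subspace `F` that avoids `W` contains a sequence which is boundedly
free modulo `W ⊔ F₀`, for finite-dimensional `F₀`: the intersection `D` of `F` with `W ⊔ F₀` is
finite-dimensional, and a sequence in `F` need only be boundedly free modulo `D`. -/
theorem IsFNorm.exists_isBoundedlyFree_sup (hp : IsFNorm 𝕜 p) {F W : Submodule 𝕜 E}
    (hF : IsClosed (F : Set E)) (hFinf : ℵ₀ ≤ Module.rank 𝕜 F) (hFW : ∀ g ∈ F, g ∈ W → g = 0)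
    (F₀ : Submodule 𝕜 E) [FiniteDimensional 𝕜 F₀] :
    ∃ x : ℕ → E, IsBoundedlyFree p x (W ⊔ F₀) := by
  set D : Submodule 𝕜 E := F ⊓ (W ⊔ F₀) with hD
  have hDfg : D.FG := by
    refine Submodule.fg_of_fg_map_of_fg_inf_ker W.mkQ ?_ ?_
    · refine Submodule.FG.of_le_of_isNoetherian (T := F₀.map W.mkQ) ?_
      refine (Submodule.map_mono inf_le_right).trans ?_
      rw [Submodule.map_sup,
        (LinearMap.le_ker_iff_map (f := W.mkQ)).1 (Submodule.ker_mkQ W).ge, bot_sup_eq]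
    · have : D ⊓ W.mkQ.ker = ⊥ := by
        rw [Submodule.ker_mkQ, eq_bot_iff]
        exact fun g hg => hFW g hg.1.1 hg.2
      rw [this]
      exact Submodule.fg_bot
  have : FiniteDimensional 𝕜 D := Module.Finite.of_fg hDfg
  have hinf : ¬ FiniteDimensional 𝕜 (F.map D.mkQ) := by
    intro hfin
    have hFfg : F.FG := by
      refine Submodule.fg_of_fg_map_of_fg_inf_ker D.mkQ (Module.Finite.iff_fg.1 hfin) ?_
      rw [Submodule.ker_mkQ]
      exact Submodule.FG.of_le_of_isNoetherian inf_le_right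
    have : FiniteDimensional 𝕜 F := Module.Finite.of_fg hFfg
    exact hFinf.not_gt (Module.rank_lt_aleph0 𝕜 F)
  obtain ⟨v, hv⟩ := exists_linearIndependent_nat hinf
  choose e heF he using fun n => (v n).2
  have hind : LinearIndependent 𝕜 fun n => D.mkQ (e n) := by
    simp_rw [he]
    exact hv.map' (F.map D.mkQ).subtype (Submodule.ker_subtype _)
  obtain ⟨a, ha⟩ := hp.exists_isBoundedlyFree D.closed_of_finiteDimensional hind
  refine ⟨_, ha.summable, fun c hc s hs hcs => ha.eq_zero c hc s ⟨?_, hs⟩ hcs⟩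
  exact hF.mem_of_tendsto hcs (Eventually.of_forall fun N =>
    F.sum_mem fun i _ => F.smul_mem _ (F.smul_mem _ (heF i)))

end

theorem mainTheorem3 {𝕜 : Type*} [RCLike 𝕜] {E : Type*} [AddCommGroup E] [Module 𝕜 E]
    [TopologicalSpace E] [IsFSpace 𝕜 E] (W : Submodule 𝕜 E)
    (hW : ∃ Y : Submodule 𝕜 E, Y ≤ W ∧ IsClosed (Y : Set E) ∧ ¬ IsMinimalTVS 𝕜 Y) :
    [IsSpaceable 𝕜 (W : Set E)ᶜ,
      ∃ S : Submodule 𝕜 (lp (fun _ : ℕ => 𝕜) ∞), IsClosed (S : Set (lp (fun _ : ℕ => 𝕜) ∞)) ∧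
        (∀ c : lp (fun _ : ℕ => 𝕜) ∞, Tendsto (fun n => c n) atTop (𝓝 0) → c ∈ S) ∧
        ∃ x : ℕ → E, SeqIndependent x (S.map (linftyToSeq 𝕜)) ∧
          SeqLineable x (S.map (linftyToSeq 𝕜)) (W : Set E)ᶜ,
      ∀ n : ℕ, 1 ≤ n → IsPairSpaceable 𝕜 n 𝔠 (W : Set E)ᶜ].TFAE := by
  obtain ⟨hT2, p, hp⟩ := IsFSpace.exists_isFNorm 𝕜 E
  have hfc := hp.firstCountable
  obtain ⟨Y, hYW, hY, hmin⟩ := hW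
  tfae_have 1 → 2 := by
    rintro ⟨F, hF, hFinf, hFW⟩
    obtain ⟨x, hx⟩ := hp.exists_isBoundedlyFree_sup hF hFinf
      (subset_compl_union_zero_iff.1 hFW) ⊥
    rw [sup_bot_eq] at hx
    obtain ⟨h1, h2⟩ := hx.seqIndependent_and_seqLineable hp
    exact ⟨⊤, isClosed_univ, fun _ _ => trivial, x, h1, h2⟩
  tfae_have 2 → 1 := by
    rintro ⟨S, -, hS, x, hind, hlin⟩
    obtain ⟨y, hy⟩ := hp.exists_isBoundedlyFree_of_seqLineable hS hind hlin
    obtain ⟨z, hz, hzW⟩ := hy.exists_closed hp hYW hY hmin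
    refine ⟨_, Submodule.isClosed_topologicalClosure _, ?_, subset_compl_union_zero_iff.2 hzW⟩
    exact Cardinal.aleph0_le_continuum.trans (hp.continuum_le_rank
      (Submodule.isClosed_topologicalClosure _) hz fun n =>
        Submodule.le_topologicalClosure _ (Submodule.subset_span ⟨n, rfl⟩))
  tfae_have 1 → 3 := by
    rintro ⟨F, hF, hFinf, hFW⟩ n -
    refine ⟨?_, fun F₀ hF₀ hF₀W => ?_⟩
    · obtain ⟨F', hF'F, hF'⟩ := F.exists_le_rank_eq hFinf n
      exact ⟨F', hF', fun g hg => (hFW (hF'F hg.1)).resolve_right hg.2⟩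
    · have : FiniteDimensional 𝕜 F₀ :=
        Module.rank_lt_aleph0_iff.1 (hF₀ ▸ Cardinal.natCast_lt_aleph0)
      obtain ⟨x, hx⟩ := hp.exists_isBoundedlyFree_sup hF hFinf
        (subset_compl_union_zero_iff.1 hFW) F₀
      obtain ⟨z, hz, hzW⟩ := hx.exists_closed hp (hYW.trans le_sup_left) hY hmin
      set G := (Submodule.span 𝕜 (Set.range z)).topologicalClosure with hG
      have hGc : IsClosed (G : Set E) := Submodule.isClosed_topologicalClosure _
      refine ⟨G ⊔ F₀, G.isClosed_sup_finiteDimensional F₀ hGc, le_antisymm ?_ ?_, le_sup_right, ?_⟩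
      · refine (Submodule.rank_add_le_rank_add_rank G F₀).trans ?_
        rw [hF₀]
        exact Cardinal.add_le_of_le Cardinal.aleph0_le_continuum
          (rank_closure_span_le_continuum z) (Cardinal.nat_lt_continuum n).le
      · exact (hp.continuum_le_rank hGc hz fun n =>
          Submodule.le_topologicalClosure _ (Submodule.subset_span ⟨n, rfl⟩)).trans
            (Submodule.rank_mono le_sup_left)
      · refine subset_compl_union_zero_iff.2 fun g hg hgW => ?_
        obtain ⟨g₁, hg₁, g₂, hg₂, rfl⟩ := Submodule.mem_sup.1 hg
        have h1 : g₁ = 0 := hzW g₁ hg₁ (by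
          have := Submodule.sub_mem (W ⊔ F₀) (Submodule.mem_sup_left hgW)
            (Submodule.mem_sup_right hg₂)
          rwa [add_sub_cancel_right] at this)
        rw [h1, zero_add] at hgW ⊢
        exact subset_compl_union_zero_iff.1 hF₀W g₂ hg₂ hgW
  tfae_have 3 → 1 := by
    intro h
    obtain ⟨⟨F, hF, hFW⟩, h2⟩ := h 1 le_rfl
    obtain ⟨G, hG, hGr, -, hGW⟩ := h2 F hF fun g hg => by
      by_cases h0 : g = 0
      exacts [Or.inr h0, Or.inl (hFW ⟨hg, h0⟩)]
    exact ⟨G, hG, hGr ▸ Cardinal.aleph0_le_continuum, hGW⟩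
  tfae_finish
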